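/- **Proposition 1.** Let $0<\alpha<1$, $\delta\ge 0$, $\gamma_1,\dots,\gamma_K>0$, and let $S_1,\dots,S_K$ be independent with $S_k\sim\mathrm{Stable}(\alpha,1,\gamma_k,\delta)$, where $\mathrm{Stable}(\alpha,\beta,\gamma,\delta)$ (with $\alpha\ne1$) denotes the law with characteristic function $$u\mapsto \exp\bigl[-\gamma^\alpha|u|^\alpha\{1-i\beta\tan(\pi\alpha/2)\,\mathrm{sign}(u)\}+i\delta u\bigr].$$ Let $\mathcal S\subseteq\mathbb R^2$, let $w_k(\boldsymbol s,r_k)\ge 0$, $k=1,\dots,K$, be basis functions with $\sum_{k=1}^K w_k(\boldsymbol s,r_k)=1$ for all $\boldsymbol s\in\mathcal S$, and put $$R(\boldsymbol s)=\sum_{k=1}^K w_k(\boldsymbol s,r_k)S_k,\qquad \bar\gamma(\boldsymbol s)=\Bigl[\sum_{k=1}^K\{w_k(\boldsymbol s,r_k)\gamma_k\}^\alpha\Bigr]^{1/\alpha}.$$ Let $\{Z(\boldsymbol s)\}_{\boldsymbol s\in\mathcal S}$ be a real-valued process independent of $(S_1,\dots,S_K)$, and let $g$ be a measurable link function such that $g(Z(\boldsymbol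 s))$ is standard Pareto for every $\boldsymbol s\in\mathcal S$, that is, $\Pr\{g(Z(\boldsymbol s))>x\}=x^{-1}$ for $x\ge 1$. Let $\phi:\mathcal S\to\mathbb R$ and $X(\boldsymbol s)=R(\boldsymbol s)^{\phi(\boldsymbol s)}g(Z(\boldsymbol s))$. Fix $\boldsymbol s_j\in\mathcal S$ and write $X_j,R_j,\phi_j,\bar\gamma_j$ for the values at $\boldsymbol s_j$. With $C_\alpha=\Gamma(\alpha)\sin(\alpha\pi/2)/\pi$, as $x\to\infty$: - if $0\le\phi_j<\alpha$, then $\mathbb E(R_j^{\phi_j})<\infty$ and $\Pr(X_j>x)\sim \mathbb E(R_j^{\phi_j})\,x^{-1}$; - if $\phi_j>\alpha$, then $\Pr(X_j>x)\sim \dfrac{2C_\alpha\bar\gamma_j^\alpha}{1-\alpha/\phi_j}\,x^{-\alpha/\phi_j}$; - if $\phi_j=\alpha$, then $\Pr(X_j>x)\sim 2C_\alpha\bar\gamma_j^\alpha\,x^{-1}\log x$. -/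

import Mathlib

open MeasureTheory ProbabilityTheory Filter Asymptotics

noncomputable section

/-- The function `ω(u)` in the characteristic function of a stable law (1-parameterization). -/
def stableOmega (α u : ℝ) : ℝ :=
  if α = 1 then -(2 / Real.pi) * Real.log |u| else Real.tan (Real.pi * α / 2)

/-- `Y` has the law `Stable(α, β, γ, δ)` under `P`, in the 1-parameterization:
`E exp(iuY) = exp(-γ^α |u|^α (1 - i β ω(u) sign(u)) + i δ u)` for all real `u`. -/
structure HasStableLaw {Ω : Type*} [MeasurableSpace Ω] (Y : Ω → ℝ) (P : Measure Ω)
    (α β γ δ : ℝ) : Prop where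
  alpha_pos : 0 < α
  alpha_le : α ≤ 2
  neg_one_le_beta : -1 ≤ β
  beta_le_one : β ≤ 1
  gamma_pos : 0 < γ
  aemeasurable : AEMeasurable Y P
  charFun_eq : ∀ u : ℝ, charFun (P.map Y) u =
    Complex.exp (-((γ ^ α * |u| ^ α : ℝ) : ℂ) *
        (1 - Complex.I * ((β * stableOmega α u * Real.sign u : ℝ) : ℂ))
      + Complex.I * ((δ * u : ℝ) : ℂ))

/-- The constant `C_α = Γ(α) sin(απ/2) / π`. -/
def stableTailConst (α : ℝ) : ℝ :=
  Real.Gamma α * Real.sin (α * Real.pi / 2) / Real.pi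

/-- The scaling process `R(s) = ∑ₖ wₖ(s, rₖ) Sₖ`. -/
def scalingProcess {Ω : Type*} {K : ℕ}
    (w : Fin K → EuclideanSpace ℝ (Fin 2) → ℝ → ℝ) (r : Fin K → ℝ) (S : Fin K → Ω → ℝ)
    (s : EuclideanSpace ℝ (Fin 2)) (ω : Ω) : ℝ :=
  ∑ k, w k s (r k) * S k ω

/-- The scale `γ̄(s) = (∑ₖ (wₖ(s, rₖ) γₖ)^α)^(1/α)`. -/
def scaleBar {K : ℕ} (α : ℝ)
    (w : Fin K → EuclideanSpace ℝ (Fin 2) → ℝ → ℝ) (r γ : Fin K → ℝ)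
    (s : EuclideanSpace ℝ (Fin 2)) : ℝ :=
  (∑ k, (w k s (r k) * γ k) ^ α) ^ (1 / α)

/-- The mixture process `X(s) = R(s)^φ(s) g(Z(s))` on the spatial domain `D`. -/
def mixtureProcess {Ω : Type*} {K : ℕ} {D : Set (EuclideanSpace ℝ (Fin 2))}
    (w : Fin K → EuclideanSpace ℝ (Fin 2) → ℝ → ℝ) (r : Fin K → ℝ) (S : Fin K → Ω → ℝ)
    (φ : D → ℝ) (g : ℝ → ℝ) (Z : D → Ω → ℝ) (s : D) (ω : Ω) : ℝ :=
  scalingProcess w r S s ω ^ φ s * g (Z s ω)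

end

/-! As the weights at `s` sum to one, `R(s)` is again totally skewed stable with the same index and
location, and its exponent has coefficient `c = γ̄(s)^α` (`charFun_map_sum_stable`). What is needed
about `R(s)` is then read off by comparison with a Pareto law of index `α`.

The integral of `(1 - exp(iux)) x^(-α-1)` over `(0, ∞)` is a multiple of `(-iu)^α`, hence of the
skewed stable exponent `ψ(u)`. So a Pareto law of suitable scale has characteristic function `1 - c
ψ(u) + O(|u|)`. This has two consequences. Sums of `n` i.i.d. Pareto variables, rescaled by
`n^(-1/α)` and shifted by `δ ≥ 0`, converge in law to `R(s)`, which is therefore nonnegative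
(`measure_Iio_zero_of_charFun_eq`). And the two characteristic functions differ by `o(|u|^α)`, which
by Parseval against smooth cutoffs makes the tails agree to order `t^(-α)`
(`tendsto_rpow_mul_tail_of_charFun_sub_isLittleO`); hence `t^α Pr(R > t) → 2 C_α c`.

For `T = R^φ ≥ 0` and an independent standard Pareto `V`, conditioning on `T` gives `Pr(TV > x) =
x⁻¹ E min(x, T)`, and `E min(x, T)` is the integral of `Pr(T > t)` over `(0, x)`
(`measureReal_lt_mul_pareto`, `integral_min_eq_intervalIntegral`). For `φ > 0` the integrand behaves
like a constant times `t^(-α/φ)`: its integral converges to `E T` if `φ < α`, grows like a power if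
`φ > α`, and like a logarithm if `φ = α`. If `φ = 0`, then `T = 1`. -/

open scoped Topology

noncomputable section

/-! ### The Bernstein function of a power-law density. -/

/-- The Bernstein function `∫₀^∞ (1 - exp (-z x)) x^(-α-1) dx` of the measure with density
`x^(-α-1)`. -/
def powerLawExponent (α : ℝ) (z : ℂ) : ℂ :=
  ∫ x in Set.Ioi (0 : ℝ), (1 - Complex.exp (-z * x)) * ((x ^ (-α - 1) : ℝ) : ℂ)

lemma norm_exp_sub_one_le_norm {w : ℂ} (hw : w.re ≤ 0) : ‖Complex.exp w - 1‖ ≤ ‖w‖ := by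
  have h := Convex.norm_image_sub_le_of_norm_deriv_le (𝕜 := ℂ) (f := Complex.exp)
    (s := {z : ℂ | z.re ≤ 0}) (x := 0) (y := w) (C := 1)
    (fun x _ => Complex.differentiableAt_exp) ?_ (convex_halfSpace_re_le 0) (by simp) hw
  · simpa using h
  · intro x hx
    rw [Complex.deriv_exp, Complex.norm_exp]
    exact Real.exp_le_one_iff.2 hx

lemma norm_exp_sub_one_le_two {w : ℂ} (hw : w.re ≤ 0) : ‖Complex.exp w - 1‖ ≤ 2 := by
  have h : ‖Complex.exp w‖ ≤ 1 := by
    rw [Complex.norm_exp]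
    exact Real.exp_le_one_iff.2 hw
  calc ‖Complex.exp w - 1‖ ≤ ‖Complex.exp w‖ + ‖(1 : ℂ)‖ := norm_sub_le _ _
    _ ≤ 2 := by rw [norm_one]; linarith

/-- The term `M * x` tames the singularity at `0`, where `x^(-α)` is integrable because `α < 1`; the
constant `2` handles infinity, where `α > 0` suffices. This is the dominating function for the
Bernstein integrand. -/
lemma integrableOn_min_mul_rpow {α : ℝ} (hα0 : 0 < α) (hα1 : α < 1) {M : ℝ} (hM : 0 ≤ M) :
    IntegrableOn (fun x : ℝ => min 2 (M * x) * x ^ (-α - 1)) (Set.Ioi 0) := by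
  have hmeas : Measurable fun x : ℝ => min 2 (M * x) * x ^ (-α - 1) := by fun_prop
  rw [← Set.Ioc_union_Ioi_eq_Ioi zero_le_one]
  refine IntegrableOn.union ?_ ?_
  · have h1 : IntegrableOn (fun x : ℝ => M * x ^ (-α)) (Set.Ioc 0 1) := by
      refine Integrable.const_mul ?_ M
      rw [← IntegrableOn, integrableOn_Ioc_iff_integrableOn_Ioo,
        intervalIntegral.integrableOn_Ioo_rpow_iff one_pos]
      linarith
    refine h1.mono' hmeas.aestronglyMeasurable ?_
    filter_upwards [ae_restrict_mem measurableSet_Ioc] with x hx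
    have hx0 : 0 < x := hx.1
    have hp : 0 ≤ x ^ (-α - 1) := Real.rpow_nonneg hx0.le _
    rw [Real.norm_of_nonneg (mul_nonneg (le_min zero_le_two (by positivity)) hp)]
    calc min 2 (M * x) * x ^ (-α - 1) ≤ (M * x) * x ^ (-α - 1) := by
          gcongr
          exact min_le_right _ _
      _ = M * x ^ (-α) := by
          rw [mul_assoc, ← Real.rpow_one_add' hx0.le (by linarith)]
          congr 2
          ring
  · have h1 : IntegrableOn (fun x : ℝ => 2 * x ^ (-α - 1)) (Set.Ioi 1) :=
      (integrableOn_Ioi_rpow_of_lt (by linarith) one_pos).const_mul 2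
    refine h1.mono' hmeas.aestronglyMeasurable ?_
    filter_upwards [ae_restrict_mem measurableSet_Ioi] with x hx
    have hx0 : 0 < x := zero_lt_one.trans hx
    have hp : 0 ≤ x ^ (-α - 1) := Real.rpow_nonneg hx0.le _
    rw [Real.norm_of_nonneg (mul_nonneg (le_min zero_le_two (by positivity)) hp)]
    gcongr
    exact min_le_left _ _

lemma norm_powerLawExponent_integrand_le {α : ℝ} {z : ℂ} (hz : 0 ≤ z.re) {M : ℝ} (hM : ‖z‖ ≤ M)
    {x : ℝ} (hx : 0 < x) :
    ‖(1 - Complex.exp (-z * x)) * ((x ^ (-α - 1) : ℝ) : ℂ)‖ ≤ min 2 (M * x) * x ^ (-α - 1) := by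
  have hp : 0 ≤ x ^ (-α - 1) := Real.rpow_nonneg hx.le _
  have hre : (-z * x).re ≤ 0 := by
    simp only [neg_mul, Complex.neg_re, Complex.re_mul_ofReal]
    nlinarith
  rw [norm_mul, Complex.norm_real, Real.norm_of_nonneg hp, norm_sub_rev]
  gcongr
  refine le_min (norm_exp_sub_one_le_two hre) ((norm_exp_sub_one_le_norm hre).trans ?_)
  rw [norm_mul, norm_neg, Complex.norm_real, Real.norm_of_nonneg hx.le]
  gcongr

lemma aestronglyMeasurable_powerLawExponent_integrand (α : ℝ) (z : ℂ) (μ : Measure ℝ) :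
    AEStronglyMeasurable
      (fun x : ℝ => (1 - Complex.exp (-z * x)) * ((x ^ (-α - 1) : ℝ) : ℂ)) μ := by
  have : Measurable (fun x : ℝ => (1 - Complex.exp (-z * x)) * ((x ^ (-α - 1) : ℝ) : ℂ)) := by
    fun_prop
  exact this.aestronglyMeasurable

lemma integrableOn_powerLawExponent_integrand {α : ℝ} (hα0 : 0 < α) (hα1 : α < 1) {z : ℂ}
    (hz : 0 ≤ z.re) :
    IntegrableOn (fun x : ℝ => (1 - Complex.exp (-z * x)) * ((x ^ (-α - 1) : ℝ) : ℂ))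
      (Set.Ioi 0) := by
  refine (integrableOn_min_mul_rpow hα0 hα1 (norm_nonneg z)).mono'
    (aestronglyMeasurable_powerLawExponent_integrand α z _) ?_
  filter_upwards [ae_restrict_mem measurableSet_Ioi] with x hx
  exact norm_powerLawExponent_integrand_le hz le_rfl hx

/-- Characteristic functions live at `z = -iu`, on the boundary of the half-plane of holomorphy, and
this continuity is what reaches them. -/
lemma continuousWithinAt_powerLawExponent {α : ℝ} (hα0 : 0 < α) (hα1 : α < 1) (z : ℂ) :
    ContinuousWithinAt (powerLawExponent α) {w | 0 ≤ w.re} z := by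
  refine continuousWithinAt_of_dominated
    (bound := fun x => min 2 ((‖z‖ + 1) * x) * x ^ (-α - 1))
    (Eventually.of_forall fun w => aestronglyMeasurable_powerLawExponent_integrand α w _) ?_
    (integrableOn_min_mul_rpow hα0 hα1 (by positivity)) ?_
  · have hev : ∀ᶠ w : ℂ in 𝓝[{w | 0 ≤ w.re}] z, ‖w‖ < ‖z‖ + 1 :=
      nhdsWithin_le_nhds (continuous_norm.continuousAt.eventually_lt_const (by linarith))
    filter_upwards [hev, self_mem_nhdsWithin] with w hw hre
    filter_upwards [ae_restrict_mem measurableSet_Ioi] with x hx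
    exact norm_powerLawExponent_integrand_le hre hw.le hx
  · refine Eventually.of_forall fun x => Continuous.continuousWithinAt ?_
    fun_prop

lemma hasDerivAt_powerLawExponent {α : ℝ} (hα0 : 0 < α) (hα1 : α < 1) {z : ℂ} (hz : 0 < z.re) :
    HasDerivAt (powerLawExponent α)
      (∫ x in Set.Ioi (0 : ℝ), Complex.exp (-z * x) * ((x ^ (-α) : ℝ) : ℂ)) z := by
  -- Staying at real part above `z.re / 2` gives one exponential bound for all nearby `w`.
  have hs : {w : ℂ | z.re / 2 < w.re} ∈ 𝓝 z :=
    (isOpen_lt continuous_const Complex.continuous_re).mem_nhds (show z.re / 2 < z.re by linarith)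
  have hmeas : Measurable fun x : ℝ => Complex.exp (-z * x) * ((x ^ (-α) : ℝ) : ℂ) := by fun_prop
  have hbound : IntegrableOn (fun x : ℝ => x ^ (-α) * Real.exp (-(z.re / 2) * x)) (Set.Ioi 0) := by
    simpa using integrableOn_rpow_mul_exp_neg_mul_rpow (p := 1) (s := -α) (b := z.re / 2)
      (by linarith) one_pos (by linarith)
  refine (hasDerivAt_integral_of_dominated_loc_of_deriv_le
    (F := fun (w : ℂ) (x : ℝ) => (1 - Complex.exp (-w * x)) * ((x ^ (-α - 1) : ℝ) : ℂ))
    (F' := fun (w : ℂ) (x : ℝ) => Complex.exp (-w * x) * ((x ^ (-α) : ℝ) : ℂ))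
    (bound := fun x => x ^ (-α) * Real.exp (-(z.re / 2) * x)) hs
    (Eventually.of_forall fun w => aestronglyMeasurable_powerLawExponent_integrand α w _)
    (integrableOn_powerLawExponent_integrand hα0 hα1 hz.le) hmeas.aestronglyMeasurable
    ?_ hbound ?_).2
  · filter_upwards [ae_restrict_mem measurableSet_Ioi] with x hx w hw
    have hx0 : 0 < x := hx
    have hp : 0 ≤ x ^ (-α) := Real.rpow_nonneg hx0.le _
    rw [norm_mul, Complex.norm_real, Real.norm_of_nonneg hp, mul_comm, Complex.norm_exp]
    gcongr
    simp only [neg_mul, Complex.neg_re, Complex.re_mul_ofReal]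
    have : z.re / 2 < w.re := hw
    nlinarith
  · filter_upwards [ae_restrict_mem measurableSet_Ioi] with x hx w _
    have hx0 : 0 < x := hx
    have hp : (x : ℂ) * ((x ^ (-α - 1) : ℝ) : ℂ) = ((x ^ (-α) : ℝ) : ℂ) := by
      rw [← Complex.ofReal_mul, ← Real.rpow_one_add' hx0.le (by linarith)]
      congr 2
      ring
    have h1 : HasDerivAt (fun w : ℂ => -w * (x : ℂ)) (-1 * (x : ℂ)) w :=
      ((hasDerivAt_id w).neg).mul_const _
    have h2 := ((h1.cexp.const_sub 1).mul_const ((x ^ (-α - 1) : ℝ) : ℂ))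
    refine h2.congr_deriv ?_
    rw [← hp]
    ring

/-- Substitute `c * x` for `x` in the integral; the density is homogeneous. -/
lemma powerLawExponent_ofReal_mul {α : ℝ} {c : ℝ} (hc : 0 < c) (z : ℂ) :
    powerLawExponent α (c * z) = ((c ^ α : ℝ) : ℂ) * powerLawExponent α z := by
  have h := integral_comp_mul_left_Ioi'
    (fun x : ℝ => (1 - Complex.exp (-z * x)) * ((x ^ (-α - 1) : ℝ) : ℂ)) 0 hc
  rw [mul_zero] at h
  unfold powerLawExponent
  rw [← h, Complex.real_smul, ← mul_assoc, ← integral_const_mul]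
  refine setIntegral_congr_fun measurableSet_Ioi fun x hx => ?_
  have hx0 : 0 < x := hx
  have hcc : c ^ α * c * c ^ (-α - 1) = 1 := by
    nth_rw 2 [← Real.rpow_one c]
    rw [← Real.rpow_add hc, ← Real.rpow_add hc]
    simp
  simp only [Real.mul_rpow hc.le hx0.le]
  rw [show -(↑c * z) * (x : ℂ) = -z * ((c * x : ℝ) : ℂ) by push_cast; ring]
  have hcc' : ((c ^ α : ℝ) : ℂ) * c * ((c ^ (-α - 1) : ℝ) : ℂ) = 1 := by exact_mod_cast hcc
  rw [Complex.ofReal_mul (c ^ (-α - 1))]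
  linear_combination -((1 - Complex.exp (-z * ((c * x : ℝ) : ℂ))) * ((x ^ (-α - 1) : ℝ) : ℂ)) * hcc'

/-- Euler's relation for the homogeneous function `powerLawExponent`. -/
lemma mul_deriv_powerLawExponent {α : ℝ} (hα0 : 0 < α) (hα1 : α < 1) {z : ℂ} (hz : 0 < z.re) :
    z * deriv (powerLawExponent α) z = α * powerLawExponent α z := by
  have hd := (hasDerivAt_powerLawExponent hα0 hα1 hz).differentiableAt.hasDerivAt
  -- Differentiate `c ↦ powerLawExponent α (c * z)` at `c = 1` in two ways: by the chain rule and by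
  -- homogeneity.
  have hline : HasDerivAt (fun c : ℝ => (c : ℂ) * z) z 1 := by
    simpa using (Complex.ofRealCLM.hasDerivAt (x := (1 : ℝ))).mul_const z
  have h1 : HasDerivAt (fun c : ℝ => powerLawExponent α ((c : ℂ) * z))
      (deriv (powerLawExponent α) z * z) 1 := by
    have hd' : HasDerivAt (powerLawExponent α) (deriv (powerLawExponent α) z)
      (((1 : ℝ) : ℂ) * z) := by simpa using hd
    exact hd'.comp (1 : ℝ) hline
  have h2 : HasDerivAt (fun c : ℝ => powerLawExponent α ((c : ℂ) * z))
      (α * powerLawExponent α z) 1 := by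
    have h3 : HasDerivAt (fun c : ℝ => c ^ α) α 1 := by
      simpa using Real.hasDerivAt_rpow_const (x := 1) (p := α) (Or.inl one_ne_zero)
    refine (h3.ofReal_comp.mul_const (powerLawExponent α z)).congr_of_eventuallyEq ?_
    filter_upwards [lt_mem_nhds (zero_lt_one (α := ℝ))] with c hc
    exact powerLawExponent_ofReal_mul hc z
  rw [mul_comm, h1.unique h2]

/-- Euler's relation at `z = 1` replaces the value by the derivative, which is a Gamma integral; no
integration by parts is needed. -/
lemma powerLawExponent_one {α : ℝ} (hα0 : 0 < α) (hα1 : α < 1) :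
    powerLawExponent α 1 = ((Real.Gamma (1 - α) / α : ℝ) : ℂ) := by
  have h := mul_deriv_powerLawExponent hα0 hα1 (z := 1) (by simp)
  rw [(hasDerivAt_powerLawExponent hα0 hα1 (z := 1) (by simp)).deriv] at h
  have hG : (∫ x in Set.Ioi (0 : ℝ), Complex.exp (-1 * x) * ((x ^ (-α) : ℝ) : ℂ)) =
      ((Real.Gamma (1 - α) : ℝ) : ℂ) := by
    rw [Real.Gamma_eq_integral (by linarith), ← integral_complex_ofReal]
    refine setIntegral_congr_fun measurableSet_Ioi fun x _ => ?_
    simp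
  rw [hG, one_mul] at h
  have hα : (α : ℂ) ≠ 0 := by exact_mod_cast hα0.ne'
  rw [Complex.ofReal_div, h]
  field_simp

/-- By Euler's relation the quotient by `z^α` has zero derivative on the connected half-plane, so it
equals its value at `1`. -/
lemma powerLawExponent_eq_of_re_pos {α : ℝ} (hα0 : 0 < α) (hα1 : α < 1) {z : ℂ}
    (hz : 0 < z.re) :
    powerLawExponent α z = ((Real.Gamma (1 - α) / α : ℝ) : ℂ) * z ^ (α : ℂ) := by
  have hderiv : ∀ w : ℂ, 0 < w.re →
      HasDerivAt (fun w => powerLawExponent α w * w ^ (-(α : ℂ))) 0 w := by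
    intro w hw
    have hw0 : w ≠ 0 := fun h => by simp [h] at hw
    have h1 := (hasDerivAt_powerLawExponent hα0 hα1 hw).differentiableAt.hasDerivAt
    have h2 := (hasDerivAt_id w).cpow_const (c := -(α : ℂ)) (Or.inl hw)
    refine (h1.mul h2).congr_deriv ?_
    have h3 := mul_deriv_powerLawExponent hα0 hα1 hw
    have h4 : w ^ (-(α : ℂ)) = w * w ^ (-(α : ℂ) - 1) := by
      rw [Complex.cpow_sub _ _ hw0, Complex.cpow_one]
      field_simp
    simp only [id]
    rw [h4]
    linear_combination w ^ (-(α : ℂ) - 1) * h3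
  have hconst := IsOpen.is_const_of_deriv_eq_zero (𝕜 := ℂ)
    (isOpen_lt continuous_const Complex.continuous_re)
    (convex_halfSpace_re_gt 0).isPreconnected
    (fun w hw => (hderiv w hw).differentiableAt.differentiableWithinAt)
    (fun w hw => (hderiv w hw).deriv) (x := z) (y := 1) hz (by simp)
  have hz0 : z ≠ 0 := fun h => by simp [h] at hz
  simp only [Complex.one_cpow, mul_one] at hconst
  rw [← powerLawExponent_one hα0 hα1, ← hconst, mul_assoc, ← Complex.cpow_add _ _ hz0]
  simp

/-- Approach `z` along `z + ε` with `ε ↓ 0`. The power is continuous there because `z.im = -u ≠ 0`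
keeps `z` off the branch cut. -/
lemma powerLawExponent_neg_I_mul {α : ℝ} (hα0 : 0 < α) (hα1 : α < 1) {u : ℝ} (hu : u ≠ 0) :
    powerLawExponent α (-(Complex.I * u)) =
      ((Real.Gamma (1 - α) / α : ℝ) : ℂ) * (-(Complex.I * u)) ^ (α : ℂ) := by
  set z : ℂ := -(Complex.I * u) with hzdef
  have hlim : Tendsto (fun ε : ℝ => z + ε) (𝓝[>] 0) (𝓝 z) := by
    have : Continuous fun ε : ℝ => z + ε := by fun_prop
    simpa using (this.tendsto 0).mono_left nhdsWithin_le_nhds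
  have hzre : z.re = 0 := by simp [hzdef]
  have hzim : z.im = -u := by simp [hzdef]
  have hlimW : Tendsto (fun ε : ℝ => z + ε) (𝓝[>] 0) (𝓝[{w | 0 ≤ w.re}] z) := by
    refine tendsto_nhdsWithin_iff.2 ⟨hlim, ?_⟩
    filter_upwards [self_mem_nhdsWithin] with ε hε
    simpa [hzre] using le_of_lt hε
  have h1 := (continuousWithinAt_powerLawExponent hα0 hα1 z).tendsto.comp hlimW
  have h2 : Tendsto (fun ε : ℝ => ((Real.Gamma (1 - α) / α : ℝ) : ℂ) * (z + ε) ^ (α : ℂ))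
      (𝓝[>] 0) (𝓝 (((Real.Gamma (1 - α) / α : ℝ) : ℂ) * z ^ (α : ℂ))) := by
    refine Tendsto.const_mul _ ?_
    refine ((continuousAt_cpow_const (b := (α : ℂ)) (Or.inr ?_)).tendsto).comp hlim
    rw [hzim]
    simpa using hu
  refine tendsto_nhds_unique (h1.congr' ?_) h2
  filter_upwards [self_mem_nhdsWithin] with ε hε
  refine powerLawExponent_eq_of_re_pos hα0 hα1 ?_
  simpa [hzre] using hε

/-! ### The skewed stable exponent. -/

/-- The exponent `|u|^α (1 - i tan(πα/2) sign(u))` of the totally skewed stable law. -/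
def skewedExponent (α u : ℝ) : ℂ :=
  ((|u| ^ α : ℝ) : ℂ) * (1 - Complex.I * ((Real.tan (Real.pi * α / 2) * Real.sign u : ℝ) : ℂ))

lemma cos_pi_mul_div_two_pos {α : ℝ} (hα0 : 0 < α) (hα1 : α < 1) :
    0 < Real.cos (Real.pi * α / 2) := by
  have := Real.pi_pos
  exact Real.cos_pos_of_mem_Ioo ⟨by nlinarith, by nlinarith⟩

/-- The principal argument of `-iu` is `-(π/2) sign(u)`; pulling the cosine out of the resulting
exponential leaves the tangent. -/
lemma neg_I_mul_cpow {α : ℝ} (hα0 : 0 < α) (hα1 : α < 1) {u : ℝ} (hu : u ≠ 0) :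
    (-(Complex.I * u)) ^ (α : ℂ) = Real.cos (Real.pi * α / 2) * skewedExponent α u := by
  have hcos := (cos_pi_mul_div_two_pos hα0 hα1).ne'
  have hz0 : -(Complex.I * u) ≠ 0 := by simpa using hu
  have habs : 0 < |u| := abs_pos.2 hu
  have hlog : Complex.log (-(Complex.I * u)) =
      ((Real.log |u| : ℝ) : ℂ) + ((-(Real.pi / 2) * Real.sign u : ℝ) : ℂ) * Complex.I := by
    rcases lt_or_gt_of_ne hu with h | h
    · rw [show -(Complex.I * u) = ((|u| : ℝ) : ℂ) * Complex.I by
        rw [abs_of_neg h]; push_cast; ring, Complex.log_ofReal_mul habs Complex.I_ne_zero,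
        Complex.log_I, Real.sign_of_neg h]
      push_cast
      ring
    · rw [show -(Complex.I * u) = ((|u| : ℝ) : ℂ) * (-Complex.I) by
        rw [abs_of_pos h]; ring,
        Complex.log_ofReal_mul habs (neg_ne_zero.2 Complex.I_ne_zero), Complex.log_neg_I,
        Real.sign_of_pos h]
      push_cast
      ring
  have hreal : Real.exp (Real.log |u| * α) = |u| ^ α := by
    rw [Real.rpow_def_of_pos habs]
  rw [Complex.cpow_def_of_ne_zero hz0, hlog, add_mul, Complex.exp_add, ← Complex.ofReal_mul,
    ← Complex.ofReal_exp, hreal,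
    show ((-(Real.pi / 2) * Real.sign u : ℝ) : ℂ) * Complex.I * (α : ℂ) =
      ((-(Real.pi * α / 2) * Real.sign u : ℝ) : ℂ) * Complex.I by push_cast; ring,
    Complex.exp_mul_I, ← Complex.ofReal_cos, ← Complex.ofReal_sin, skewedExponent,
    Real.tan_eq_sin_div_cos]
  have hcos' : ((Real.cos (Real.pi * α / 2) : ℝ) : ℂ) ≠ 0 := by exact_mod_cast hcos
  rcases lt_or_gt_of_ne hu with h | h
  · rw [Real.sign_of_neg h, mul_neg_one, neg_neg]
    push_cast
    push_cast at hcos'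
    field_simp
    ring
  · rw [Real.sign_of_pos h, mul_one, Real.cos_neg, Real.sin_neg]
    push_cast
    push_cast at hcos'
    field_simp
    ring

lemma norm_skewedExponent_le (α u : ℝ) :
    ‖skewedExponent α u‖ ≤ (1 + |Real.tan (Real.pi * α / 2)|) * |u| ^ α := by
  have hp : 0 ≤ |u| ^ α := Real.rpow_nonneg (abs_nonneg u) _
  have hs : |Real.sign u| ≤ 1 := by
    rcases Real.sign_apply_eq u with h | h | h <;> simp [h]
  rw [skewedExponent, norm_mul, Complex.norm_real, Real.norm_of_nonneg hp, mul_comm]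
  gcongr
  refine (norm_sub_le _ _).trans ?_
  rw [norm_one, norm_mul, Complex.norm_I, one_mul, Complex.norm_real, Real.norm_eq_abs, abs_mul]
  gcongr
  exact mul_le_of_le_one_right (abs_nonneg _) hs

/-! ### Pareto laws and their characteristic functions near zero. -/

lemma integral_paretoMeasure {E : Type*} [NormedAddCommGroup E] [NormedSpace ℝ E] {b α : ℝ}
    (hb : 0 < b) (hα : 0 < α) (f : ℝ → E) :
    ∫ x, f x ∂paretoMeasure b α = ∫ x in Set.Ioi b, (α * b ^ α * x ^ (-α - 1)) • f x := by
  rw [paretoMeasure, integral_withDensity_eq_integral_toReal_smul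
    (by unfold paretoPDF; fun_prop) (by simp [paretoPDF]), ← integral_Ici_eq_integral_Ioi,
    ← integral_indicator measurableSet_Ici]
  congr 1 with x
  by_cases hx : b ≤ x
  · have hx0 : 0 < x := hb.trans_le hx
    rw [Set.indicator_of_mem (by exact hx), paretoPDF_of_le hx,
      ENNReal.toReal_ofReal (by positivity), neg_add']
  · rw [Set.indicator_of_notMem (by exact hx), paretoPDF_of_lt (not_le.1 hx)]
    simp

lemma measureReal_paretoMeasure_Ioi {b α t : ℝ} (hb : 0 < b) (hα : 0 < α) (ht : b ≤ t) :
    (paretoMeasure b α).real (Set.Ioi t) = b ^ α * t ^ (-α) := by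
  have ht0 : 0 < t := hb.trans_le ht
  rw [← integral_indicator_one measurableSet_Ioi, integral_paretoMeasure hb hα]
  have h : ∀ x, (α * b ^ α * x ^ (-α - 1)) • (Set.Ioi t).indicator (1 : ℝ → ℝ) x =
      (Set.Ioi t).indicator (fun x => α * b ^ α * x ^ (-α - 1)) x := by
    intro x
    by_cases hx : x ∈ Set.Ioi t <;> simp [hx]
  simp_rw [h]
  rw [setIntegral_indicator measurableSet_Ioi, Set.inter_eq_right.2 (Set.Ioi_subset_Ioi ht),
    integral_const_mul, integral_Ioi_rpow_of_lt (by linarith) ht0]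
  have : -α - 1 + 1 = -α := by ring
  rw [this]
  field_simp

lemma paretoMeasure_Iio {b α : ℝ} : paretoMeasure b α (Set.Iio b) = 0 := by
  rw [paretoMeasure, withDensity_apply _ measurableSet_Iio, lintegral_paretoPDF_of_le le_rfl]

/-- Expansion at `0` of the characteristic function of a Pareto law of index `α < 1`. -/
lemma norm_charFun_paretoMeasure_sub_le {α b : ℝ} (hα0 : 0 < α) (hα1 : α < 1) (hb : 0 < b)
    (u : ℝ) :
    ‖charFun (paretoMeasure b α) u - 1 +
        ((b ^ α * Real.Gamma (1 - α) * Real.cos (Real.pi * α / 2) : ℝ) : ℂ) * skewedExponent α u‖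
      ≤ α * b ^ α * (b ^ (1 - α) / (1 - α)) * |u| := by
  have := isProbabilityMeasure_paretoMeasure hb hα0
  have hp1 : 0 < 1 - α := by linarith
  rcases eq_or_ne u 0 with rfl | hu
  · simp [skewedExponent, Real.zero_rpow hα0.ne']
  set z : ℂ := -(Complex.I * u) with hz
  have hzre : z.re = 0 := by simp [hz]
  have hznorm : ‖z‖ = |u| := by simp [hz]
  set k : ℝ → ℂ := fun x => (1 - Complex.exp (-z * x)) * ((x ^ (-α - 1) : ℝ) : ℂ) with hk
  have hkint : IntegrableOn k (Set.Ioi 0) :=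
    integrableOn_powerLawExponent_integrand hα0 hα1 hzre.ge
  have hcf : charFun (paretoMeasure b α) u - 1 =
      -((α * b ^ α : ℝ) : ℂ) * ∫ x in Set.Ioi b, k x := by
    have h1 : charFun (paretoMeasure b α) u - 1 =
        ∫ x, (Complex.exp (u * x * Complex.I) - 1) ∂paretoMeasure b α := by
      rw [integral_sub, charFun_apply_real]
      · simp
      · refine (integrable_const (1 : ℝ)).mono (by fun_prop) (Eventually.of_forall fun x => ?_)
        rw [← Complex.ofReal_mul, Complex.norm_exp_ofReal_mul_I, norm_one]
      · exact integrable_const 1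
    rw [h1, integral_paretoMeasure hb hα0, ← integral_const_mul]
    refine setIntegral_congr_fun measurableSet_Ioi fun x _ => ?_
    simp only [hk, Complex.real_smul]
    rw [show (u : ℂ) * x * Complex.I = -z * x by rw [hz]; ring]
    push_cast
    ring
  -- The integral over `(0, ∞)` has the closed form, while the Pareto law sees only `(b, ∞)`. The
  -- piece over `(0, b]` is the whole error, and it is linear in `|u|`.
  have hsplit : powerLawExponent α z = (∫ x in Set.Ioc 0 b, k x) + ∫ x in Set.Ioi b, k x := by
    unfold powerLawExponent
    rw [← setIntegral_union (Set.Ioc_disjoint_Ioi le_rfl) measurableSet_Ioi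
      (hkint.mono_set Set.Ioc_subset_Ioi_self) (hkint.mono_set (Set.Ioi_subset_Ioi hb.le)),
      Set.Ioc_union_Ioi_eq_Ioi hb.le]
  have hval := powerLawExponent_neg_I_mul hα0 hα1 hu
  rw [neg_I_mul_cpow hα0 hα1 hu, ← hz, hsplit] at hval
  have hα : (α : ℂ) ≠ 0 := by exact_mod_cast hα0.ne'
  have hmain : charFun (paretoMeasure b α) u - 1 +
      ((b ^ α * Real.Gamma (1 - α) * Real.cos (Real.pi * α / 2) : ℝ) : ℂ) * skewedExponent α u =
      ((α * b ^ α : ℝ) : ℂ) * ∫ x in Set.Ioc 0 b, k x := by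
    rw [hcf]
    have h2 : (α : ℂ) * ((Real.Gamma (1 - α) / α : ℝ) : ℂ) = Real.Gamma (1 - α) := by
      push_cast
      field_simp
    rw [eq_comm, ← sub_eq_zero] at hval
    rw [Complex.ofReal_mul (b ^ α * _), Complex.ofReal_mul (b ^ α), ← h2,
      Complex.ofReal_mul α]
    linear_combination (α : ℂ) * ((b ^ α : ℝ) : ℂ) * hval
  rw [hmain, norm_mul, Complex.norm_real, Real.norm_of_nonneg (by positivity),
    mul_assoc (α * b ^ α)]
  gcongr
  have hint : IntegrableOn (fun x : ℝ => |u| * x ^ (-α)) (Set.Ioc 0 b) := by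
    refine Integrable.const_mul ?_ _
    rw [← IntegrableOn, integrableOn_Ioc_iff_integrableOn_Ioo,
      intervalIntegral.integrableOn_Ioo_rpow_iff hb]
    linarith
  refine (norm_integral_le_of_norm_le hint ?_).trans_eq ?_
  · filter_upwards [ae_restrict_mem measurableSet_Ioc] with x hx
    have hx0 : 0 < x := hx.1
    refine (norm_powerLawExponent_integrand_le hzre.ge hznorm.le hx0).trans ?_
    calc min 2 (|u| * x) * x ^ (-α - 1) ≤ (|u| * x) * x ^ (-α - 1) := by
          gcongr
          exact min_le_right _ _
      _ = |u| * x ^ (-α) := by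
          rw [mul_assoc, ← Real.rpow_one_add' hx0.le (by linarith)]
          congr 2
          ring
  · rw [integral_const_mul, ← intervalIntegral.integral_of_le hb.le,
      integral_rpow (Or.inl (by linarith)), show -α + 1 = 1 - α by ring,
      Real.zero_rpow hp1.ne', sub_zero, mul_comm]

/-- With `α < 1`, linear terms are negligible at order `|u|^α`: this disposes both of the location
`δ` and of the Pareto truncation error. -/
lemma isLittleO_id_abs_rpow {α : ℝ} (hα1 : α < 1) :
    (fun u : ℝ => u) =o[𝓝 0] fun u : ℝ => |u| ^ α := by
  have hcont : Tendsto (fun u : ℝ => |u| ^ (1 - α)) (𝓝 0) (𝓝 0) := by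
    have h : ContinuousAt (fun u : ℝ => |u| ^ (1 - α)) 0 :=
      (continuous_abs.continuousAt).rpow_const (Or.inr (by linarith))
    simpa [ContinuousAt, Real.zero_rpow (show 1 - α ≠ 0 by linarith)] using h
  have h : (fun u : ℝ => |u| ^ (1 - α) * |u| ^ α) =o[𝓝 0] fun u : ℝ => 1 * |u| ^ α :=
    ((isLittleO_one_iff ℝ).2 hcont).mul_isBigO (isBigO_refl _ _)
  simp only [one_mul] at h
  refine IsLittleO.of_norm_left (h.congr_left fun u => ?_)
  rcases eq_or_ne u 0 with rfl | hu
  · simp [Real.zero_rpow (show 1 - α ≠ 0 by linarith)]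
  · rw [← Real.rpow_add (abs_pos.2 hu)]
    simp

lemma isLittleO_charFun_paretoMeasure {α b : ℝ} (hα0 : 0 < α) (hα1 : α < 1) (hb : 0 < b) :
    (fun u : ℝ => charFun (paretoMeasure b α) u - 1 +
        ((b ^ α * Real.Gamma (1 - α) * Real.cos (Real.pi * α / 2) : ℝ) : ℂ) * skewedExponent α u)
      =o[𝓝 0] fun u : ℝ => |u| ^ α :=
  (IsBigO.of_bound _ (Eventually.of_forall fun u => norm_charFun_paretoMeasure_sub_le hα0 hα1 hb u)
    ).trans_isLittleO (isLittleO_id_abs_rpow hα1)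

lemma isLittleO_exp_skewedExponent {α : ℝ} (hα0 : 0 < α) (hα1 : α < 1) (c δ : ℝ) :
    (fun u : ℝ => Complex.exp (-(c : ℂ) * skewedExponent α u + Complex.I * ((δ * u : ℝ) : ℂ)) - 1
        + (c : ℂ) * skewedExponent α u) =o[𝓝 0] fun u : ℝ => |u| ^ α := by
  have hψ : (fun u : ℝ => -(c : ℂ) * skewedExponent α u) =O[𝓝 0] fun u : ℝ => |u| ^ α := by
    refine IsBigO.const_mul_left ?_ _
    refine IsBigO.of_bound (1 + |Real.tan (Real.pi * α / 2)|) (Eventually.of_forall fun u => ?_)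
    rw [Real.norm_of_nonneg (Real.rpow_nonneg (abs_nonneg u) _)]
    exact norm_skewedExponent_le α u
  have hδ : (fun u : ℝ => Complex.I * ((δ * u : ℝ) : ℂ)) =o[𝓝 0] fun u : ℝ => |u| ^ α := by
    refine IsBigO.trans_isLittleO ?_ (isLittleO_id_abs_rpow hα1)
    refine IsBigO.of_bound |δ| (Eventually.of_forall fun u => ?_)
    simp
  have hw := hψ.add hδ.isBigO
  have hpow : Tendsto (fun u : ℝ => |u| ^ α) (𝓝 0) (𝓝 0) := by
    have h : ContinuousAt (fun u : ℝ => |u| ^ α) 0 :=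
      (continuous_abs.continuousAt).rpow_const (Or.inr hα0.le)
    simpa [ContinuousAt, Real.zero_rpow hα0.ne'] using h
  have hw0 := hw.trans_tendsto hpow
  have hexp : (fun w : ℂ => Complex.exp w - 1 - w) =o[𝓝 0] fun w : ℂ => w := by
    have h := (Complex.hasDerivAt_exp 0).isLittleO
    simpa using h
  have h2 := ((hexp.comp_tendsto hw0).trans_isBigO hw).add hδ
  refine h2.congr_left fun u => ?_
  simp only [Function.comp_apply]
  ring

/-! ### Transfer of power tails between laws. -/

open scoped FourierTransform SchwartzMap

/-- Parseval's formula for a Schwartz function and a probability measure. -/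
lemma integral_schwartzMap_div_eq (χ : 𝓢(ℝ, ℂ)) (μ : Measure ℝ) [IsProbabilityMeasure μ]
    (t : ℝ) :
    ∫ x, χ (x / t) ∂μ = ∫ v, (𝓕 χ) v * charFun μ (2 * Real.pi * v / t) := by
  have hinv : ∀ y : ℝ, χ y =
      ∫ v, Complex.exp (((2 * Real.pi * v * y : ℝ) : ℂ) * Complex.I) * (𝓕 χ) v := by
    intro y
    have h : 𝓕⁻ (𝓕 χ) = χ := FourierTransform.fourierInv_fourier_eq χ
    conv_lhs => rw [← h, SchwartzMap.fourierInv_coe, Real.fourierInv_eq']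
    refine integral_congr_ae (Eventually.of_forall fun v => ?_)
    simp only [smul_eq_mul, RCLike.inner_apply, conj_trivial]
    congr 4
    ring
  simp_rw [hinv]
  rw [integral_integral_swap]
  · refine integral_congr_ae (Eventually.of_forall fun v => ?_)
    simp only
    rw [integral_mul_const, charFun_apply_real, mul_comm]
    congr 2 with x
    congr 1
    push_cast
    ring
  · have hg : Integrable (fun p : ℝ × ℝ => ‖(𝓕 χ) p.2‖) (μ.prod volume) :=
      ((𝓕 χ).integrable (μ := volume)).norm.comp_snd μ
    refine hg.mono' ?_ (Eventually.of_forall fun p => ?_)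
    · refine Continuous.aestronglyMeasurable ?_
      have := (𝓕 χ).continuous
      simp only [Function.uncurry_def]
      fun_prop
    · simp only [Function.uncurry_def]
      rw [norm_mul, Complex.norm_exp_ofReal_mul_I, one_mul]

/-- By Parseval the expression is the integral of `𝓕 χ` against `t^α` times the difference of
characteristic functions at `2πv/t`. That factor tends to `0` for each `v` and is dominated through
`|y|^α ≤ 1 + |y|`, while `𝓕 χ` decays rapidly. -/
lemma tendsto_rpow_mul_integral_schwartzMap_sub {μ₁ μ₂ : Measure ℝ} [IsProbabilityMeasure μ₁]
    [IsProbabilityMeasure μ₂] {α : ℝ} (hα0 : 0 < α) (hα1 : α ≤ 1)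
    (h : (fun u => charFun μ₁ u - charFun μ₂ u) =o[𝓝 0] fun u : ℝ => |u| ^ α) (χ : 𝓢(ℝ, ℂ)) :
    Tendsto (fun t : ℝ => ((t ^ α : ℝ) : ℂ) * (∫ x, χ (x / t) ∂μ₁ - ∫ x, χ (x / t) ∂μ₂))
      atTop (𝓝 0) := by
  set d : ℝ → ℂ := fun u => charFun μ₁ u - charFun μ₂ u with hd
  have hdcont : Continuous d := by
    simp only [hd]
    exact continuous_charFun.sub continuous_charFun
  have hd2 : ∀ u, ‖d u‖ ≤ 2 := fun u => by
    have h1 := norm_charFun_le_one (μ := μ₁) u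
    have h2 := norm_charFun_le_one (μ := μ₂) u
    exact (norm_sub_le _ _).trans (by linarith)
  -- The little-o bound holds for `|u| < r`; beyond that, `2 ≤ (2 / r^α) |u|^α`.
  obtain ⟨C, hC0, hC⟩ : ∃ C : ℝ, 0 ≤ C ∧ ∀ u, ‖d u‖ ≤ C * |u| ^ α := by
    have h1 := h.bound one_pos
    obtain ⟨r, hr, hr1⟩ := Metric.eventually_nhds_iff.1 h1
    refine ⟨max 1 (2 / r ^ α), by positivity, fun u => ?_⟩
    have hp : 0 ≤ |u| ^ α := Real.rpow_nonneg (abs_nonneg u) _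
    have hrp : 0 < r ^ α := Real.rpow_pos_of_pos hr _
    rcases lt_or_ge |u| r with hu | hu
    · have h2 := hr1 (y := u) (by simpa using hu)
      rw [Real.norm_of_nonneg hp] at h2
      exact h2.trans (by gcongr; exact le_max_left _ _)
    · calc ‖d u‖ ≤ 2 := hd2 u
        _ = 2 / r ^ α * r ^ α := by field_simp
        _ ≤ max 1 (2 / r ^ α) * |u| ^ α := by
          gcongr
          exact le_max_right _ _
  have hint : ∀ (μ : Measure ℝ) [IsProbabilityMeasure μ] (t : ℝ),
      Integrable (fun v => (𝓕 χ) v * charFun μ (2 * Real.pi * v / t)) := by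
    intro μ _ t
    refine ((𝓕 χ).integrable (μ := volume)).norm.mono' ?_ (Eventually.of_forall fun v => ?_)
    · have h1 := (𝓕 χ).continuous
      have h2 : Continuous (charFun μ) := continuous_charFun
      exact (by fun_prop : Continuous
        fun v => (𝓕 χ) v * charFun μ (2 * Real.pi * v / t)).aestronglyMeasurable
    · rw [norm_mul]
      exact mul_le_of_le_one_right (norm_nonneg _) (norm_charFun_le_one _)
  have heq : ∀ t : ℝ,
      ((t ^ α : ℝ) : ℂ) * (∫ x, χ (x / t) ∂μ₁ - ∫ x, χ (x / t) ∂μ₂) =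
      ∫ v, (𝓕 χ) v * (((t ^ α : ℝ) : ℂ) * d (2 * Real.pi * v / t)) := by
    intro t
    rw [integral_schwartzMap_div_eq, integral_schwartzMap_div_eq, ← integral_sub (hint _ _)
      (hint _ _), ← integral_const_mul]
    refine integral_congr_ae (Eventually.of_forall fun v => ?_)
    simp only [hd]
    ring
  simp_rw [heq]
  have hscale : ∀ (v : ℝ), ∀ t : ℝ, 0 < t →
      t ^ α * |2 * Real.pi * v / t| ^ α = |2 * Real.pi * v| ^ α := by
    intro v t ht
    rw [abs_div, abs_of_pos ht, Real.div_rpow (abs_nonneg _) ht.le]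
    have := (Real.rpow_pos_of_pos ht α).ne'
    field_simp
  have hlim := tendsto_integral_filter_of_dominated_convergence (μ := volume) (l := atTop)
    (F := fun (t : ℝ) v => (𝓕 χ) v * (((t ^ α : ℝ) : ℂ) * d (2 * Real.pi * v / t)))
    (f := fun _ => 0)
    (fun v => ‖(𝓕 χ) v‖ * (C * (1 + 2 * Real.pi * |v|))) ?_ ?_ ?_ ?_
  · simpa using hlim
  · refine Eventually.of_forall fun t => ?_
    have h1 := (𝓕 χ).continuous
    exact (by fun_prop : Continuous
      fun v => (𝓕 χ) v * (((t ^ α : ℝ) : ℂ) * d (2 * Real.pi * v / t))).aestronglyMeasurable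
  · filter_upwards [eventually_gt_atTop 0] with t ht
    refine Eventually.of_forall fun v => ?_
    have htp : 0 ≤ t ^ α := Real.rpow_nonneg ht.le _
    rw [norm_mul, norm_mul, Complex.norm_real, Real.norm_of_nonneg htp]
    refine mul_le_mul_of_nonneg_left ?_ (norm_nonneg _)
    calc t ^ α * ‖d (2 * Real.pi * v / t)‖ ≤ t ^ α * (C * |2 * Real.pi * v / t| ^ α) := by
          gcongr
          exact hC _
      _ = C * |2 * Real.pi * v| ^ α := by rw [← hscale v t ht]; ring
      _ ≤ C * (1 + 2 * Real.pi * |v|) := by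
          gcongr
          have habs : |2 * Real.pi * v| = 2 * Real.pi * |v| := by
            rw [abs_mul, abs_of_pos Real.two_pi_pos]
          rw [habs]
          have hnn : 0 ≤ 2 * Real.pi * |v| := by positivity
          rcases le_total (2 * Real.pi * |v|) 1 with h1 | h1
          · have := Real.rpow_le_one hnn h1 hα0.le
            linarith
          · have := Real.rpow_le_rpow_of_exponent_le h1 hα1
            rw [Real.rpow_one] at this
            linarith
  · have h0 := ((𝓕 χ).integrable (μ := volume)).norm
    have h1 := (𝓕 χ).integrable_pow_mul volume 1
    refine ((h0.const_mul C).add (h1.const_mul (C * (2 * Real.pi)))).congr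
      (Eventually.of_forall fun v => ?_)
    simp only [Pi.add_apply, pow_one, Real.norm_eq_abs]
    ring
  · refine Eventually.of_forall fun v => ?_
    have hto : Tendsto (fun t : ℝ => 2 * Real.pi * v / t) atTop (𝓝 0) :=
      tendsto_const_nhds.div_atTop tendsto_id
    have h1 := h.comp_tendsto hto
    have h2 : (fun t : ℝ => ((t ^ α : ℝ) : ℂ) * d (2 * Real.pi * v / t)) =o[atTop]
        fun t : ℝ => t ^ α * |2 * Real.pi * v / t| ^ α := by
      refine IsBigO.mul_isLittleO ?_ h1
      exact IsBigO.of_norm_left (by simpa using isBigO_refl _ _)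
    have h3 : (fun t : ℝ => ((t ^ α : ℝ) : ℂ) * d (2 * Real.pi * v / t)) =o[atTop]
        fun _ : ℝ => |2 * Real.pi * v| ^ α := by
      refine h2.congr' EventuallyEq.rfl ?_
      filter_upwards [eventually_gt_atTop 0] with t ht
      exact hscale v t ht
    have h4 : Tendsto (fun t : ℝ => ((t ^ α : ℝ) : ℂ) * d (2 * Real.pi * v / t)) atTop (𝓝 0) :=
      (isLittleO_one_iff ℝ).1 (h3.trans_isBigO (isBigO_const_one ℝ _ _))
    simpa using h4.const_mul ((𝓕 χ) v)

/-- The cutoff `χ(x/t)` is `1` for `|x| ≤ t` and `0` for `|x| ≥ χ.rOut * t`, so `1 - χ(x/t)` lies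
between two indicators. -/
lemma one_sub_integral_contDiffBump_bounds (μ : Measure ℝ) [IsProbabilityMeasure μ]
    (χ : ContDiffBump (0 : ℝ)) (hin : χ.rIn = 1) {t : ℝ} (ht : 0 < t) :
    μ.real {x | χ.rOut * t < |x|} ≤ 1 - ∫ x, χ (x / t) ∂μ ∧
      1 - ∫ x, χ (x / t) ∂μ ≤ μ.real {x | t < |x|} := by
  have hcont : Continuous fun x : ℝ => χ (x / t) := χ.continuous.comp (by fun_prop)
  have hint : Integrable (fun x : ℝ => χ (x / t)) μ := by
    refine (integrable_const (1 : ℝ)).mono' hcont.aestronglyMeasurable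
      (Eventually.of_forall fun x => ?_)
    rw [Real.norm_of_nonneg χ.nonneg]
    exact χ.le_one
  have hmeas : ∀ c : ℝ, MeasurableSet {x : ℝ | c < |x|} := fun c =>
    measurableSet_lt measurable_const measurable_norm
  have heq : 1 - ∫ x, χ (x / t) ∂μ = ∫ x, (1 - χ (x / t)) ∂μ := by
    rw [integral_sub (integrable_const _) hint]
    simp
  have hind : ∀ c : ℝ, Integrable ({x : ℝ | c < |x|}.indicator (1 : ℝ → ℝ)) μ := fun c =>
    (integrable_const (1 : ℝ)).indicator (hmeas c)
  rw [heq, ← integral_indicator_one (hmeas _), ← integral_indicator_one (hmeas _)]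
  constructor
  · refine integral_mono (hind _) ((integrable_const _).sub hint) fun x => ?_
    by_cases hx : χ.rOut * t < |x|
    · rw [Set.indicator_of_mem (by exact hx), χ.zero_of_le_dist]
      · simp
      · rw [dist_zero_right, Real.norm_eq_abs, abs_div, abs_of_pos ht, le_div_iff₀ ht]
        exact hx.le
    · rw [Set.indicator_of_notMem (by exact hx)]
      simpa using χ.le_one
  · refine integral_mono ((integrable_const _).sub hint) (hind _) fun x => ?_
    by_cases hx : t < |x|
    · rw [Set.indicator_of_mem (by exact hx)]
      simpa using χ.nonneg
    · rw [Set.indicator_of_notMem (by exact hx), χ.one_of_mem_closedBall]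
      · simp
      · rw [mem_closedBall_zero_iff, hin, Real.norm_eq_abs, abs_div, abs_of_pos ht,
          div_le_one ht]
        exact not_lt.1 hx

/-- If the characteristic functions of two laws agree to order `o(|u|^α)` at `0`, then a power
tail of order `t^(-α)` of one of them is inherited by the other. -/
theorem tendsto_rpow_mul_tail_of_charFun_sub_isLittleO {μ₁ μ₂ : Measure ℝ}
    [IsProbabilityMeasure μ₁] [IsProbabilityMeasure μ₂] {α : ℝ} (hα0 : 0 < α) (hα1 : α ≤ 1)
    (h : (fun u => charFun μ₁ u - charFun μ₂ u) =o[𝓝 0] fun u : ℝ => |u| ^ α) {c : ℝ}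
    (h₂ : Tendsto (fun t : ℝ => t ^ α * μ₂.real {x | t < |x|}) atTop (𝓝 c)) :
    Tendsto (fun t : ℝ => t ^ α * μ₁.real {x | t < |x|}) atTop (𝓝 c) := by
  have hdiff : ∀ χ : ContDiffBump (0 : ℝ),
      Tendsto (fun t : ℝ => t ^ α * (∫ x, χ (x / t) ∂μ₁ - ∫ x, χ (x / t) ∂μ₂)) atTop (𝓝 0) := by
    intro χ
    have hcs : HasCompactSupport fun x => ((χ x : ℝ) : ℂ) :=
      χ.hasCompactSupport.comp_left (g := Complex.ofReal) rfl
    have h1 := tendsto_rpow_mul_integral_schwartzMap_sub hα0 hα1 h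
      (hcs.toSchwartzMap (Complex.ofRealCLM.contDiff.comp χ.contDiff))
    have h2 := (Complex.continuous_re.tendsto 0).comp h1
    rw [Complex.zero_re] at h2
    refine h2.congr fun t => ?_
    have hval : ∀ μ : Measure ℝ, ∫ x, (hcs.toSchwartzMap
        (Complex.ofRealCLM.contDiff.comp χ.contDiff)) (x / t) ∂μ =
        ((∫ x, χ (x / t) ∂μ : ℝ) : ℂ) := fun μ => integral_complex_ofReal
    rw [Function.comp_apply, hval, hval, ← Complex.ofReal_sub, ← Complex.ofReal_mul,
      Complex.ofReal_re]
  have hpow : ∀ ρ : ℝ, 1 < ρ → ∀ t : ℝ, 0 < t → (ρ * t) ^ α = ρ ^ α * t ^ α :=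
    fun ρ hρ t ht => Real.mul_rpow (by linarith) ht.le
  rw [tendsto_order]
  constructor
  · intro a ha
    -- A cutoff falling from `1` to `0` between `t` and `ρ t` costs a factor `ρ^(-α)`, harmless for
    -- `ρ` close to `1`.
    have hc : Tendsto (fun ρ : ℝ => (ρ ^ α)⁻¹ * c) (𝓝[>] 1) (𝓝 c) := by
      have : ContinuousAt (fun ρ : ℝ => (ρ ^ α)⁻¹ * c) 1 :=
        ((continuousAt_id.rpow_const (Or.inr hα0.le)).inv₀ (by simp)).mul continuousAt_const
      simpa [ContinuousAt] using this.mono_left nhdsWithin_le_nhds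
    obtain ⟨ρ, hρa, hρ⟩ := ((hc.eventually_const_lt ha).and self_mem_nhdsWithin).exists
    have hρ1 : (1 : ℝ) < ρ := hρ
    have hρp : 0 < ρ ^ α := Real.rpow_pos_of_pos (by linarith) _
    let χ : ContDiffBump (0 : ℝ) := ⟨1, ρ, one_pos, hρ1⟩
    have hT : Tendsto (fun t : ℝ => ρ * t) atTop atTop :=
      tendsto_id.const_mul_atTop (by linarith)
    have hlow : Tendsto (fun t : ℝ => (ρ ^ α)⁻¹ * ((ρ * t) ^ α * μ₂.real {x | ρ * t < |x|}) -
        t ^ α * (∫ x, χ (x / t) ∂μ₁ - ∫ x, χ (x / t) ∂μ₂)) atTop (𝓝 ((ρ ^ α)⁻¹ * c)) := by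
      simpa using ((h₂.comp hT).const_mul (ρ ^ α)⁻¹).sub (hdiff χ)
    filter_upwards [hlow.eventually_const_lt hρa, eventually_gt_atTop 0] with t hlt ht
    refine hlt.trans_le ?_
    have b1 := (one_sub_integral_contDiffBump_bounds μ₁ χ rfl ht).2
    have b2 := (one_sub_integral_contDiffBump_bounds μ₂ χ rfl ht).1
    have htp : 0 ≤ t ^ α := Real.rpow_nonneg ht.le _
    rw [hpow ρ hρ1 t ht, ← mul_assoc, ← mul_assoc, inv_mul_cancel₀ hρp.ne', one_mul, ← mul_sub]
    gcongr
    change μ₂.real {x | ρ * t < |x|} ≤ _ at b2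
    linarith
  · intro a ha
    have hc : Tendsto (fun ρ : ℝ => ρ ^ α * c) (𝓝[>] 1) (𝓝 c) := by
      have : ContinuousAt (fun ρ : ℝ => ρ ^ α * c) 1 :=
        (continuousAt_id.rpow_const (Or.inr hα0.le)).mul continuousAt_const
      simpa [ContinuousAt] using this.mono_left nhdsWithin_le_nhds
    obtain ⟨ρ, hρa, hρ⟩ := ((hc.eventually_lt_const ha).and self_mem_nhdsWithin).exists
    have hρ1 : (1 : ℝ) < ρ := hρ
    have hρ0 : 0 < ρ := by linarith
    let χ : ContDiffBump (0 : ℝ) := ⟨1, ρ, one_pos, hρ1⟩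
    -- For the upper bound the cutoff has scale `t / ρ`, so that it vanishes beyond exactly `t`.
    have hT : Tendsto (fun t : ℝ => t / ρ) atTop atTop := tendsto_id.atTop_div_const hρ0
    have hup : Tendsto (fun t : ℝ => ρ ^ α * ((t / ρ) ^ α * μ₂.real {x | t / ρ < |x|} -
        (t / ρ) ^ α * (∫ x, χ (x / (t / ρ)) ∂μ₁ - ∫ x, χ (x / (t / ρ)) ∂μ₂))) atTop
        (𝓝 (ρ ^ α * c)) := by
      simpa using ((h₂.comp hT).sub ((hdiff χ).comp hT)).const_mul (ρ ^ α)
    filter_upwards [hup.eventually_lt_const hρa, eventually_gt_atTop 0] with t hlt ht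
    refine lt_of_le_of_lt ?_ hlt
    have htρ : 0 < t / ρ := by positivity
    have b1 := (one_sub_integral_contDiffBump_bounds μ₁ χ rfl htρ).1
    have b2 := (one_sub_integral_contDiffBump_bounds μ₂ χ rfl htρ).2
    change μ₁.real {x | ρ * (t / ρ) < |x|} ≤ _ at b1
    rw [mul_div_cancel₀ t hρ0.ne'] at b1
    have htp : 0 ≤ t ^ α := Real.rpow_nonneg ht.le _
    have hts : ρ ^ α * (t / ρ) ^ α = t ^ α := by
      rw [← hpow ρ hρ1 _ htρ, mul_div_cancel₀ t hρ0.ne']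
    rw [← mul_sub, ← mul_assoc, hts]
    gcongr
    linarith

/-! ### Pareto sums and nonnegativity of the stable law. -/

lemma skewedExponent_mul {α : ℝ} (hα0 : 0 < α) {s : ℝ} (hs : 0 ≤ s) (u : ℝ) :
    skewedExponent α (s * u) = ((s ^ α : ℝ) : ℂ) * skewedExponent α u := by
  rcases hs.eq_or_lt with rfl | hs
  · simp [skewedExponent, Real.zero_rpow hα0.ne']
  · have hsign : Real.sign (s * u) = Real.sign u := by
      rcases lt_trichotomy u 0 with h | rfl | h
      · rw [Real.sign_of_neg h, Real.sign_of_neg (mul_neg_of_pos_of_neg hs h)]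
      · simp
      · rw [Real.sign_of_pos h, Real.sign_of_pos (mul_pos hs h)]
    rw [skewedExponent, skewedExponent, hsign, abs_mul, abs_of_pos hs,
      Real.mul_rpow hs.le (abs_nonneg _), Complex.ofReal_mul, mul_assoc]

lemma conv_Iio_zero {μ ν : Measure ℝ} [IsProbabilityMeasure μ] [IsProbabilityMeasure ν]
    (hμ : μ (Set.Iio 0) = 0) (hν : ν (Set.Iio 0) = 0) : (μ ∗ ν) (Set.Iio 0) = 0 := by
  rw [Measure.conv, Measure.map_apply (by fun_prop) measurableSet_Iio]
  have hsub : (fun p : ℝ × ℝ => p.1 + p.2) ⁻¹' Set.Iio 0 ⊆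
      (Set.Iio 0 ×ˢ Set.univ) ∪ (Set.univ ×ˢ Set.Iio 0) := by
    intro p hp
    simp only [Set.mem_preimage, Set.mem_Iio] at hp
    by_cases h : p.1 < 0
    · exact Or.inl ⟨h, trivial⟩
    · exact Or.inr ⟨trivial, by simp only [Set.mem_Iio]; linarith⟩
  refine measure_mono_null hsub (measure_union_null ?_ ?_)
  · rw [Measure.prod_prod, hμ, zero_mul]
  · rw [Measure.prod_prod, hν, mul_zero]

/-- The witness is the `n`-fold convolution of `ν`, starting from the Dirac mass at `0`. -/
lemma exists_probabilityMeasure_charFun_pow {ν : Measure ℝ} [IsProbabilityMeasure ν]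
    (hν : ν (Set.Iio 0) = 0) (n : ℕ) :
    ∃ μ : ProbabilityMeasure ℝ, (μ : Measure ℝ) (Set.Iio 0) = 0 ∧
      ∀ u, charFun (μ : Measure ℝ) u = charFun ν u ^ n := by
  induction n with
  | zero =>
    refine ⟨⟨Measure.dirac 0, inferInstance⟩, ?_, fun u => ?_⟩
    · simp
    · simp
  | succ n ih =>
    obtain ⟨μ, hμ, hcf⟩ := ih
    refine ⟨⟨(μ : Measure ℝ) ∗ ν, inferInstance⟩, conv_Iio_zero hμ hν, fun u => ?_⟩
    simp only [ProbabilityMeasure.coe_mk]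
    rw [charFun_conv, hcf, pow_succ]

/-- This scale gives the Pareto expansion the coefficient `c` of the stable exponent; `b^α` is then
the constant of the Pareto tail. -/
lemma exists_paretoScale {α c : ℝ} (hα0 : 0 < α) (hα1 : α < 1) (hc : 0 < c) :
    ∃ b : ℝ, 0 < b ∧ b ^ α = c / (Real.Gamma (1 - α) * Real.cos (Real.pi * α / 2)) ∧
      b ^ α * Real.Gamma (1 - α) * Real.cos (Real.pi * α / 2) = c := by
  have hG : 0 < Real.Gamma (1 - α) := Real.Gamma_pos_of_pos (by linarith)
  have hcos := cos_pi_mul_div_two_pos hα0 hα1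
  have hq : 0 < c / (Real.Gamma (1 - α) * Real.cos (Real.pi * α / 2)) := by positivity
  have hb : ((c / (Real.Gamma (1 - α) * Real.cos (Real.pi * α / 2))) ^ α⁻¹) ^ α =
      c / (Real.Gamma (1 - α) * Real.cos (Real.pi * α / 2)) :=
    Real.rpow_inv_rpow hq.le hα0.ne'
  refine ⟨_, Real.rpow_pos_of_pos hq _, hb, ?_⟩
  rw [hb, mul_assoc, div_mul_cancel₀ _ (by positivity)]

/-- Sums of i.i.d. Pareto variables of index `α < 1`, rescaled by `n^(-1/α)`, converge to the
totally skewed stable law on the level of characteristic functions. -/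
lemma tendsto_charFun_paretoMeasure_pow {α b : ℝ} (hα0 : 0 < α) (hα1 : α < 1) (hb : 0 < b)
    (u : ℝ) :
    Tendsto (fun n : ℕ => charFun (paretoMeasure b α) ((n : ℝ) ^ (-α⁻¹) * u) ^ n) atTop
      (𝓝 (Complex.exp (-((b ^ α * Real.Gamma (1 - α) * Real.cos (Real.pi * α / 2) : ℝ) : ℂ)
        * skewedExponent α u))) := by
  set c : ℝ := b ^ α * Real.Gamma (1 - α) * Real.cos (Real.pi * α / 2) with hc
  set v : ℕ → ℝ := fun n => (n : ℝ) ^ (-α⁻¹) * u with hv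
  have hv0 : Tendsto v atTop (𝓝 0) := by
    have h := (tendsto_rpow_neg_atTop (inv_pos.2 hα0)).comp tendsto_natCast_atTop_atTop
    simpa using h.mul_const u
  -- The normalisation is chosen so that `n * |v n|^α = |u|^α`: the main term survives
  -- multiplication by `n` and the `o(|v n|^α)` error vanishes.
  have hpow : ∀ n : ℕ, 0 < n → ((n : ℝ) ^ (-α⁻¹)) ^ α = (n : ℝ)⁻¹ := by
    intro n hn
    rw [← Real.rpow_mul (Nat.cast_nonneg n), neg_mul, inv_mul_cancel₀ hα0.ne', Real.rpow_neg_one]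
  have hlit := (isLittleO_charFun_paretoMeasure hα0 hα1 hb).comp_tendsto hv0
  have hrest : Tendsto (fun n : ℕ => (n : ℂ) * (charFun (paretoMeasure b α) (v n) - 1 +
      (c : ℂ) * skewedExponent α (v n))) atTop (𝓝 0) := by
    have h1 : (fun n : ℕ => (n : ℂ) * (charFun (paretoMeasure b α) (v n) - 1 +
        (c : ℂ) * skewedExponent α (v n))) =o[atTop] fun n : ℕ => (n : ℝ) * |v n| ^ α :=
      IsBigO.mul_isLittleO (IsBigO.of_norm_left (by simpa using isBigO_refl _ _)) hlit
    have h2 : (fun n : ℕ => (n : ℝ) * |v n| ^ α) =ᶠ[atTop] fun _ => |u| ^ α := by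
      filter_upwards [eventually_gt_atTop 0] with n hn
      have hn0 : (n : ℝ) ≠ 0 := by positivity
      have hnn : 0 ≤ (n : ℝ) ^ (-α⁻¹) := Real.rpow_nonneg (Nat.cast_nonneg n) _
      simp only [hv]
      rw [abs_mul, abs_of_nonneg hnn, Real.mul_rpow hnn (abs_nonneg u), hpow n hn]
      field_simp
    exact (isLittleO_one_iff ℝ).1
      ((h1.congr' EventuallyEq.rfl h2).trans_isBigO (isBigO_const_one ℝ _ _))
  have hmain : Tendsto (fun n : ℕ => (n : ℂ) * (charFun (paretoMeasure b α) (v n) - 1)) atTop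
      (𝓝 (-(c : ℂ) * skewedExponent α u)) := by
    have h1 := hrest.sub_const ((c : ℂ) * skewedExponent α u)
    rw [zero_sub, ← neg_mul] at h1
    refine h1.congr' ?_
    filter_upwards [eventually_gt_atTop 0] with n hn
    have hn0 : (n : ℂ) ≠ 0 := by exact_mod_cast hn.ne'
    simp only [hv]
    rw [skewedExponent_mul hα0 (Real.rpow_nonneg (Nat.cast_nonneg n) _), hpow n hn]
    push_cast
    field_simp
    ring
  refine (Complex.tendsto_one_add_pow_exp_of_tendsto hmain).congr fun n => ?_
  rw [add_sub_cancel]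

/-- The totally skewed stable law of index `α < 1` with nonnegative location is carried by
`[0, ∞)`. -/
theorem measure_Iio_zero_of_charFun_eq {α c δ : ℝ} (hα0 : 0 < α) (hα1 : α < 1) (hc : 0 < c)
    (hδ : 0 ≤ δ) {μ : Measure ℝ} [IsProbabilityMeasure μ]
    (h : ∀ u, charFun μ u =
      Complex.exp (-(c : ℂ) * skewedExponent α u + Complex.I * ((δ * u : ℝ) : ℂ))) :
    μ (Set.Iio 0) = 0 := by
  obtain ⟨b, hb, -, hbc⟩ := exists_paretoScale hα0 hα1 hc
  have := isProbabilityMeasure_paretoMeasure hb hα0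
  have hscaled : ∀ n : ℕ, ∃ m : ProbabilityMeasure ℝ, (m : Measure ℝ) (Set.Iio 0) = 0 ∧
      ∀ u, charFun (m : Measure ℝ) u =
        charFun (paretoMeasure b α) ((n : ℝ) ^ (-α⁻¹) * u) ^ n *
          Complex.exp (δ * u * Complex.I) := by
    intro n
    have hnn : 0 ≤ (n : ℝ) ^ (-α⁻¹) := Real.rpow_nonneg (Nat.cast_nonneg n) _
    have hprob : IsProbabilityMeasure ((paretoMeasure b α).map ((n : ℝ) ^ (-α⁻¹) * ·)) :=
      Measure.isProbabilityMeasure_map (by fun_prop)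
    obtain ⟨m, hm, hmcf⟩ := exists_probabilityMeasure_charFun_pow
      (ν := (paretoMeasure b α).map ((n : ℝ) ^ (-α⁻¹) * ·)) (by
        rw [Measure.map_apply (by fun_prop) measurableSet_Iio]
        refine measure_mono_null (fun x hx => ?_) (paretoMeasure_Iio (b := b))
        simp only [Set.mem_preimage, Set.mem_Iio] at hx ⊢
        by_contra hbx
        have : 0 ≤ (n : ℝ) ^ (-α⁻¹) * x := mul_nonneg hnn (by linarith)
        linarith) n
    -- Convolution with the Dirac mass at `δ` restores the location; `δ ≥ 0` keeps the support in
    -- `[0, ∞)`.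
    refine ⟨⟨(m : Measure ℝ) ∗ Measure.dirac δ, inferInstance⟩, conv_Iio_zero hm ?_, fun u => ?_⟩
    · rw [Measure.dirac_apply' _ measurableSet_Iio]
      simp [hδ]
    · simp only [ProbabilityMeasure.coe_mk]
      rw [charFun_conv, hmcf, charFun_map_mul, charFun_dirac]
      simp [mul_comm]
  choose m hm hmcf using hscaled
  have hconv : Tendsto m atTop (𝓝 (⟨μ, inferInstance⟩ : ProbabilityMeasure ℝ)) := by
    refine ProbabilityMeasure.tendsto_of_tendsto_charFun fun u => ?_
    simp only [ProbabilityMeasure.coe_mk, hmcf, h]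
    have h1 := (tendsto_charFun_paretoMeasure_pow hα0 hα1 hb u).mul_const
      (Complex.exp (δ * u * Complex.I))
    rw [hbc, ← Complex.exp_add] at h1
    convert h1 using 4
    push_cast
    ring
  -- Portmanteau for the open set `(-∞, 0)`: the limit charges it no more than the liminf, which is
  -- `0`.
  have hport := ProbabilityMeasure.le_liminf_measure_open_of_tendsto hconv
    (isOpen_Iio (a := (0 : ℝ)))
  simp only [hm, ProbabilityMeasure.coe_mk] at hport
  simpa using hport

/-! ### Tail of the skewed stable law. -/

lemma two_mul_stableTailConst {α : ℝ} (hα0 : 0 < α) (hα1 : α < 1) :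
    2 * stableTailConst α = 1 / (Real.Gamma (1 - α) * Real.cos (Real.pi * α / 2)) := by
  have hG : 0 < Real.Gamma (1 - α) := Real.Gamma_pos_of_pos (by linarith)
  have hcos := cos_pi_mul_div_two_pos hα0 hα1
  have hπ := Real.pi_pos
  have hsin : 0 < Real.sin (Real.pi * α) :=
    Real.sin_pos_of_pos_of_lt_pi (by positivity) (by nlinarith)
  -- Euler's reflection formula and the double-angle formula for `sin(πα)` identify the constant.
  have hrefl := Real.Gamma_mul_Gamma_one_sub α
  have hdouble : Real.sin (Real.pi * α) =
      2 * Real.sin (α * Real.pi / 2) * Real.cos (Real.pi * α / 2) := by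
    rw [show Real.pi * α / 2 = α * Real.pi / 2 by ring,
      show Real.pi * α = 2 * (α * Real.pi / 2) by ring, Real.sin_two_mul]
  rw [eq_div_iff hsin.ne', hdouble] at hrefl
  rw [stableTailConst, eq_div_iff (by positivity)]
  rw [mul_div_assoc', div_mul_eq_mul_div, div_eq_one_iff_eq hπ.ne']
  linear_combination hrefl

lemma stableTailConst_pos {α : ℝ} (hα0 : 0 < α) (hα1 : α < 1) : 0 < 2 * stableTailConst α := by
  have hG : 0 < Real.Gamma (1 - α) := Real.Gamma_pos_of_pos (by linarith)
  have hcos := cos_pi_mul_div_two_pos hα0 hα1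
  rw [two_mul_stableTailConst hα0 hα1]
  positivity

/-- The tail of the totally skewed stable law of index `α < 1`. -/
theorem tendsto_rpow_mul_tail_of_charFun_eq {α c δ : ℝ} (hα0 : 0 < α) (hα1 : α < 1) (hc : 0 < c)
    {μ : Measure ℝ} [IsProbabilityMeasure μ]
    (h : ∀ u, charFun μ u =
      Complex.exp (-(c : ℂ) * skewedExponent α u + Complex.I * ((δ * u : ℝ) : ℂ))) :
    Tendsto (fun t : ℝ => t ^ α * μ.real {x | t < |x|}) atTop
      (𝓝 (2 * stableTailConst α * c)) := by
  obtain ⟨b, hb, hbα, hbc⟩ := exists_paretoScale hα0 hα1 hc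
  have := isProbabilityMeasure_paretoMeasure hb hα0
  refine tendsto_rpow_mul_tail_of_charFun_sub_isLittleO (μ₂ := paretoMeasure b α) hα0 hα1.le ?_ ?_
  · have h1 := (isLittleO_exp_skewedExponent hα0 hα1 c δ).sub
      (isLittleO_charFun_paretoMeasure hα0 hα1 hb)
    rw [hbc] at h1
    refine h1.congr_left fun u => ?_
    rw [h u]
    ring
  · refine tendsto_const_nhds.congr' ?_
    filter_upwards [eventually_ge_atTop b] with t ht
    have ht0 : 0 < t := hb.trans_le ht
    have hae : {x : ℝ | t < |x|} =ᵐ[paretoMeasure b α] Set.Ioi t := by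
      have hpos : ∀ᵐ x ∂paretoMeasure b α, b ≤ x := by
        rw [ae_iff]
        simp only [not_le]
        exact paretoMeasure_Iio
      filter_upwards [hpos] with x hx
      refine propext ?_
      change t < |x| ↔ t < x
      rw [abs_of_pos (hb.trans_le hx)]
    rw [measureReal_congr hae, measureReal_paretoMeasure_Ioi hb hα0 ht, Real.rpow_neg ht0.le,
      two_mul_stableTailConst hα0 hα1, hbα]
    have := (Real.rpow_pos_of_pos ht0 α).ne'
    field_simp

/-! ### Integration of power asymptotics. -/

lemma isLittleO_intervalIntegral {d h : ℝ → ℝ} {a : ℝ}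
    (hd : ∀ x, a ≤ x → IntervalIntegrable d volume a x)
    (hh : ∀ x, a ≤ x → IntervalIntegrable h volume a x) (hh0 : ∀ x, a ≤ x → 0 ≤ h x)
    (hdh : d =o[atTop] h) (hH : Tendsto (fun x => ∫ t in a..x, h t) atTop atTop) :
    (fun x => ∫ t in a..x, d t) =o[atTop] fun x => ∫ t in a..x, h t := by
  rw [isLittleO_iff]
  intro ε hε
  -- Half of `ε` controls the integrand beyond `b`; the other half absorbs the fixed integral over
  -- `[a, b]`, since the integral of `h` diverges.
  obtain ⟨t₀, ht₀⟩ := eventually_atTop.1 (isLittleO_iff.1 hdh (half_pos hε))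
  set b := max a t₀ with hb
  have hab : a ≤ b := le_max_left _ _
  filter_upwards [eventually_ge_atTop b, hH.eventually_ge_atTop (‖∫ t in a..b, d t‖ / (ε / 2))]
    with x hx hHx
  have hax : a ≤ x := hab.trans hx
  have hdbx : IntervalIntegrable d volume b x := (hd b hab).symm.trans (hd x hax)
  have hhbx : IntervalIntegrable h volume b x := (hh b hab).symm.trans (hh x hax)
  have h1 : ‖∫ t in b..x, d t‖ ≤ ∫ t in b..x, ε / 2 * h t := by
    refine intervalIntegral.norm_integral_le_of_norm_le hx (Eventually.of_forall fun t ht => ?_)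
      (hhbx.const_mul _)
    have h2 := ht₀ t ((le_max_right a t₀).trans ht.1.le)
    rwa [Real.norm_of_nonneg (hh0 t (hab.trans ht.1.le))] at h2
  rw [intervalIntegral.integral_const_mul] at h1
  have hadd := intervalIntegral.integral_add_adjacent_intervals (hh b hab) hhbx
  have hnn : 0 ≤ ∫ t in a..b, h t :=
    intervalIntegral.integral_nonneg hab fun t ht => hh0 t ht.1
  have hHnn : 0 ≤ ∫ t in a..x, h t :=
    intervalIntegral.integral_nonneg hax fun t ht => hh0 t ht.1
  rw [← intervalIntegral.integral_add_adjacent_intervals (hd b hab) hdbx,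
    Real.norm_of_nonneg hHnn]
  rw [div_le_iff₀ (half_pos hε)] at hHx
  refine (norm_add_le _ _).trans ?_
  nlinarith

/-- As the integral of `t^(-ρ)` diverges, both the contribution of `[0, 1]` and the integrated error
`F t - c t^(-ρ)` are negligible. -/
lemma isEquivalent_integral_of_tendsto_rpow_mul {F : ℝ → ℝ} (hF : Antitone F) {ρ c : ℝ}
    (hc : 0 < c) (h : Tendsto (fun t => t ^ ρ * F t) atTop (𝓝 c))
    (hH : Tendsto (fun x : ℝ => ∫ t in (1 : ℝ)..x, t ^ (-ρ)) atTop atTop) :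
    (fun x => ∫ t in (0 : ℝ)..x, F t) ~[atTop]
      fun x => c * ∫ t in (1 : ℝ)..x, t ^ (-ρ) := by
  have hFi : ∀ a b : ℝ, IntervalIntegrable F volume a b := fun a b => hF.intervalIntegrable
  have hpi : ∀ x : ℝ, 1 ≤ x → IntervalIntegrable (fun t : ℝ => t ^ (-ρ)) volume 1 x := by
    intro x hx
    refine intervalIntegral.intervalIntegrable_rpow (Or.inr ?_)
    rw [Set.uIcc_of_le hx]
    exact fun h0 => absurd h0.1 (by norm_num)
  have hd : (fun t => F t - c * t ^ (-ρ)) =o[atTop] fun t : ℝ => t ^ (-ρ) := by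
    have h1 : (fun t => t ^ ρ * F t - c) =o[atTop] fun _ => (1 : ℝ) := by
      rw [isLittleO_one_iff]
      simpa using h.sub_const c
    have h2 := h1.mul_isBigO (isBigO_refl (fun t : ℝ => t ^ (-ρ)) atTop)
    simp only [one_mul] at h2
    refine h2.congr' ?_ EventuallyEq.rfl
    filter_upwards [eventually_gt_atTop 0] with t ht
    have := (Real.rpow_pos_of_pos ht ρ).ne'
    rw [Real.rpow_neg ht.le]
    field_simp
  have hlit := isLittleO_intervalIntegral (a := 1)
    (fun x hx => (hFi 1 x).sub ((hpi x hx).const_mul c)) hpi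
    (fun x hx => Real.rpow_nonneg (by linarith) _) hd hH
  have hconst : (fun _ : ℝ => ∫ t in (0 : ℝ)..1, F t) =o[atTop]
      fun x : ℝ => ∫ t in (1 : ℝ)..x, t ^ (-ρ) :=
    isLittleO_const_left.2 (Or.inr (tendsto_norm_atTop_atTop.comp hH))
  have hsum := (hconst.add hlit).trans_isBigO
    (isBigO_self_const_mul hc.ne' (fun x : ℝ => ∫ t in (1 : ℝ)..x, t ^ (-ρ)) atTop)
  refine hsum.congr' ?_ EventuallyEq.rfl
  filter_upwards [eventually_ge_atTop 1] with x hx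
  rw [Pi.sub_apply, intervalIntegral.integral_sub (hFi 1 x) ((hpi x hx).const_mul c),
    intervalIntegral.integral_const_mul,
    ← intervalIntegral.integral_add_adjacent_intervals (hFi 0 1) (hFi 1 x)]
  ring

lemma isEquivalent_integral_rpow_neg {ρ : ℝ} (hρ : ρ < 1) :
    Tendsto (fun x : ℝ => ∫ t in (1 : ℝ)..x, t ^ (-ρ)) atTop atTop ∧
    (fun x : ℝ => ∫ t in (1 : ℝ)..x, t ^ (-ρ)) ~[atTop] fun x => x ^ (1 - ρ) / (1 - ρ) := by
  have hp : 0 < 1 - ρ := by linarith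
  have heq : (fun x : ℝ => ∫ t in (1 : ℝ)..x, t ^ (-ρ)) =
      fun x => x ^ (1 - ρ) / (1 - ρ) + -(1 / (1 - ρ)) := by
    ext x
    rw [integral_rpow (Or.inl (by linarith)), Real.one_rpow, show -ρ + 1 = 1 - ρ by ring]
    ring
  have hto : Tendsto (fun x : ℝ => x ^ (1 - ρ) / (1 - ρ)) atTop atTop :=
    (tendsto_rpow_atTop hp).atTop_div_const hp
  rw [heq]
  exact ⟨tendsto_atTop_add_const_right _ _ hto,
    IsEquivalent.add_const_of_norm_tendsto_atTop IsEquivalent.refl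
      (tendsto_norm_atTop_atTop.comp hto)⟩

/-! ### Truncated means, tails and products with a Pareto variable. -/

section RandomVariables

variable {Ω : Type*} [MeasurableSpace Ω] {P : Measure Ω}

lemma antitone_measureReal_lt [IsProbabilityMeasure P] (T : Ω → ℝ) :
    Antitone fun t : ℝ => P.real {ω | t < T ω} :=
  fun _ _ hst => measureReal_mono fun _ hω => lt_of_le_of_lt hst hω

lemma integrable_min [IsProbabilityMeasure P] {T : Ω → ℝ} (hT : AEMeasurable T P)
    (hT0 : 0 ≤ᵐ[P] T) {x : ℝ}
    (hx : 0 ≤ x) : Integrable (fun ω => min x (T ω)) P := by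
  refine (integrable_const x).mono' (by fun_prop) ?_
  filter_upwards [hT0] with ω hω
  rw [Real.norm_of_nonneg (le_min hx hω)]
  exact min_le_left _ _

/-- Layer-cake formula; truncating at `x` removes the levels `t ≥ x`. -/
lemma integral_min_eq_intervalIntegral [IsProbabilityMeasure P] {T : Ω → ℝ}
    (hT : AEMeasurable T P) (hT0 : 0 ≤ᵐ[P] T) {x : ℝ} (hx : 0 ≤ x) :
    ∫ ω, min x (T ω) ∂P = ∫ t in (0 : ℝ)..x, P.real {ω | t < T ω} := by
  rw [(integrable_min hT hT0 hx).integral_eq_integral_meas_lt (by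
    filter_upwards [hT0] with ω hω using le_min hx hω)]
  have h : ∀ t : ℝ, P.real {ω | t < min x (T ω)} =
      (Set.Iio x).indicator (fun t => P.real {ω | t < T ω}) t := by
    intro t
    by_cases ht : t < x
    · rw [Set.indicator_of_mem (by exact ht)]
      simp [ht]
    · rw [Set.indicator_of_notMem (by exact ht)]
      simp [ht]
  simp_rw [h]
  rw [setIntegral_indicator measurableSet_Iio, intervalIntegral.integral_of_le hx,
    integral_Ioc_eq_integral_Ioo]
  rfl

lemma measure_paretoMeasure_one_lt_mul {x : ℝ} (hx : 0 < x) {t : ℝ} (ht : 0 ≤ t) :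
    paretoMeasure 1 1 {v | x < t * v} = ENNReal.ofReal (x⁻¹ * min x t) := by
  have := isProbabilityMeasure_paretoMeasure one_pos one_pos
  rcases ht.eq_or_lt with rfl | ht
  · simp [hx.le, not_lt.2 hx.le]
  have hset : {v : ℝ | x < t * v} = Set.Ioi (x / t) := by
    ext v
    exact (div_lt_iff₀' ht).symm
  rw [hset]
  rcases le_total t x with h | h
  · rw [← ofReal_measureReal, measureReal_paretoMeasure_Ioi one_pos one_pos
      ((one_le_div ht).2 h), min_eq_right h, Real.one_rpow, one_mul, Real.rpow_neg_one, inv_div,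
      div_eq_inv_mul]
  · rw [min_eq_left h, inv_mul_cancel₀ hx.ne', ENNReal.ofReal_one]
    refine le_antisymm prob_le_one ?_
    have h1 : paretoMeasure 1 1 (Set.Ioi (1 : ℝ)) = 1 := by
      rw [← ofReal_measureReal, measureReal_paretoMeasure_Ioi one_pos one_pos le_rfl]
      simp
    rw [← h1]
    exact measure_mono (Set.Ioi_subset_Ioi ((div_le_one ht).2 h))

/-- The tail of the product of a nonnegative variable and an independent standard Pareto
variable. -/
lemma measureReal_lt_mul_pareto [IsProbabilityMeasure P] {T V : Ω → ℝ}
    (hT : AEMeasurable T P) (hT0 : 0 ≤ᵐ[P] T)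
    (hV : HasLaw V (paretoMeasure 1 1) P) (hTV : IndepFun T V P) {x : ℝ} (hx : 0 < x) :
    P.real {ω | x < T ω * V ω} = x⁻¹ * ∫ ω, min x (T ω) ∂P := by
  have := isProbabilityMeasure_paretoMeasure one_pos one_pos
  have hmeas : MeasurableSet {p : ℝ × ℝ | x < p.1 * p.2} :=
    measurableSet_lt measurable_const (by fun_prop)
  have hprod : P {ω | x < T ω * V ω} =
      ((P.map T).prod (paretoMeasure 1 1)) {p : ℝ × ℝ | x < p.1 * p.2} := by
    rw [← hV.map_eq, ← hTV.map_prod_eq_prod_map_map hT hV.aemeasurable,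
      Measure.map_apply_of_aemeasurable (hT.prodMk hV.aemeasurable) hmeas]
    rfl
  -- Fubini: for fixed `T`, the Pareto probability is `x⁻¹ min(x, T)`.
  have hlint : P {ω | x < T ω * V ω} = ∫⁻ ω, ENNReal.ofReal (x⁻¹ * min x (T ω)) ∂P := by
    rw [hprod, Measure.prod_apply hmeas, lintegral_map' (measurable_measure_prodMk_left
      hmeas).aemeasurable hT]
    refine lintegral_congr_ae ?_
    filter_upwards [hT0] with ω hω
    exact measure_paretoMeasure_one_lt_mul hx hω
  rw [measureReal_def, hlint, ← ofReal_integral_eq_lintegral_ofReal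
    ((integrable_min hT hT0 hx.le).const_mul _), integral_const_mul, ENNReal.toReal_ofReal]
  · refine mul_nonneg (inv_nonneg.2 hx.le) (integral_nonneg_of_ae ?_)
    filter_upwards [hT0] with ω hω using le_min hx.le hω
  · filter_upwards [hT0] with ω hω
    exact mul_nonneg (inv_nonneg.2 hx.le) (le_min hx.le hω)

/-- Layer cake again: the tail is at most `1` near zero and `O(t^(-ρ))` with `ρ > 1` at infinity. -/
lemma integrable_of_tendsto_rpow_mul_tail [IsProbabilityMeasure P] {T : Ω → ℝ}
    (hT : AEMeasurable T P) (hT0 : 0 ≤ᵐ[P] T) {ρ c : ℝ} (hρ : 1 < ρ)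
    (h : Tendsto (fun t : ℝ => t ^ ρ * P.real {ω | t < T ω}) atTop (𝓝 c)) : Integrable T P := by
  have hFm : Measurable fun t : ℝ => P.real {ω | t < T ω} := (antitone_measureReal_lt T).measurable
  obtain ⟨t₀, ht₀, hbd⟩ : ∃ t₀ : ℝ, 0 < t₀ ∧ ∀ t, t₀ ≤ t →
      P.real {ω | t < T ω} ≤ (c + 1) * t ^ (-ρ) := by
    obtain ⟨t₁, ht₁⟩ := eventually_atTop.1 (h.eventually_le_const (lt_add_one c))
    refine ⟨max 1 t₁, by positivity, fun t ht => ?_⟩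
    have ht0 : 0 < t := lt_of_lt_of_le one_pos ((le_max_left _ _).trans ht)
    have h1 := ht₁ t ((le_max_right _ _).trans ht)
    have hp := Real.rpow_pos_of_pos ht0 ρ
    rw [Real.rpow_neg ht0.le, ← div_eq_mul_inv, le_div_iff₀ hp]
    linarith
  have hint : IntegrableOn (fun t : ℝ => P.real {ω | t < T ω}) (Set.Ioi 0) := by
    rw [← Set.Ioc_union_Ioi_eq_Ioi ht₀.le]
    refine IntegrableOn.union ?_ ?_
    · exact Measure.integrableOn_of_bounded (M := 1) (by simp) hFm.aestronglyMeasurable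
        (Eventually.of_forall fun t => by
          rw [Real.norm_of_nonneg measureReal_nonneg]
          exact measureReal_le_one)
    · refine ((integrableOn_Ioi_rpow_of_lt (neg_lt_neg hρ) ht₀).const_mul (c + 1)).mono'
        hFm.aestronglyMeasurable ?_
      filter_upwards [ae_restrict_mem measurableSet_Ioi] with t ht
      rw [Real.norm_of_nonneg measureReal_nonneg]
      exact hbd t (le_of_lt ht)
  refine ⟨hT.aestronglyMeasurable, ?_⟩
  rw [hasFiniteIntegral_iff_ofReal hT0, lintegral_eq_lintegral_meas_lt P hT0 hT]
  have h2 := hint.lintegral_lt_top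
  simpa [ofReal_measureReal] using h2

lemma tendsto_integral_min {T : Ω → ℝ} (hT0 : 0 ≤ᵐ[P] T) (hT : Integrable T P) :
    Tendsto (fun x : ℝ => ∫ ω, min x (T ω) ∂P) atTop (𝓝 (∫ ω, T ω ∂P)) := by
  refine tendsto_integral_filter_of_dominated_convergence T
    (Eventually.of_forall fun x => ?_) ?_ hT ?_
  · exact (aemeasurable_const.min hT.aemeasurable).aestronglyMeasurable
  · filter_upwards [eventually_ge_atTop 0] with x hx
    filter_upwards [hT0] with ω hω
    rw [Real.norm_of_nonneg (le_min hx hω)]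
    exact min_le_right _ _
  · refine Eventually.of_forall fun ω => tendsto_const_nhds.congr' ?_
    filter_upwards [eventually_ge_atTop (T ω)] with x hx
    exact (min_eq_right hx).symm

/-- A zero mean would force `T = 0` almost surely and hence `c = 0`. Equivalence to a constant
function requires that constant to be nonzero. -/
lemma integral_ne_zero_of_tendsto_rpow_mul_tail {T : Ω → ℝ} (hT0 : 0 ≤ᵐ[P] T)
    (hT : Integrable T P) {ρ c : ℝ} (hc : 0 < c)
    (h : Tendsto (fun t : ℝ => t ^ ρ * P.real {ω | t < T ω}) atTop (𝓝 c)) :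
    ∫ ω, T ω ∂P ≠ 0 := by
  intro h0
  rw [integral_eq_zero_iff_of_nonneg_ae hT0 hT] at h0
  refine hc.ne' (tendsto_nhds_unique h (tendsto_const_nhds.congr' ?_))
  filter_upwards [eventually_ge_atTop 0] with t ht
  have : P {ω | t < T ω} = 0 := by
    refine measure_mono_null (fun ω hω => ?_) (ae_iff.1 h0)
    exact (lt_of_le_of_lt ht hω).ne'
  simp [measureReal_def, this]

lemma tendsto_rpow_mul_tail_rpow {R : Ω → ℝ} (hR0 : 0 ≤ᵐ[P] R) {α φ c : ℝ} (hφ : 0 < φ)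
    (h : Tendsto (fun t : ℝ => t ^ α * P.real {ω | t < R ω}) atTop (𝓝 c)) :
    Tendsto (fun t : ℝ => t ^ (α / φ) * P.real {ω | t < R ω ^ φ}) atTop (𝓝 c) := by
  have h1 := h.comp (tendsto_rpow_atTop (inv_pos.2 hφ))
  refine h1.congr' ?_
  filter_upwards [eventually_gt_atTop 0] with t ht
  simp only [Function.comp_apply]
  rw [← Real.rpow_mul ht.le, ← div_eq_inv_mul]
  congr 1
  refine measureReal_congr ?_
  filter_upwards [hR0] with ω hω
  refine propext ?_
  change t ^ φ⁻¹ < R ω ↔ t < R ω ^ φ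
  rw [Real.rpow_inv_lt_iff_of_pos ht.le hω hφ]

end RandomVariables

/-! ### The three regimes. -/

section MixtureTails

variable {Ω : Type*} [MeasurableSpace Ω] {P : Measure Ω} [IsProbabilityMeasure P]
  {R V : Ω → ℝ} {α φ c : ℝ}

lemma isEquivalent_tail_rpow_mul_pareto_of_lt (hR : AEMeasurable R P) (hR0 : 0 ≤ᵐ[P] R)
    (hV : HasLaw V (paretoMeasure 1 1) P) (hRV : IndepFun R V P) (hc : 0 < c)
    (htail : Tendsto (fun t : ℝ => t ^ α * P.real {ω | t < R ω}) atTop (𝓝 c))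
    (hφ0 : 0 ≤ φ) (hφ : φ < α) :
    Integrable (fun ω => R ω ^ φ) P ∧
      (fun x : ℝ => P.real {ω | x < R ω ^ φ * V ω}) ~[atTop]
        fun x : ℝ => (∫ ω, R ω ^ φ ∂P) * x⁻¹ := by
  have hT0 : 0 ≤ᵐ[P] fun ω => R ω ^ φ := by
    filter_upwards [hR0] with ω hω using Real.rpow_nonneg hω _
  have hTm : AEMeasurable (fun ω => R ω ^ φ) P := hR.pow_const φ
  have hTV : IndepFun (fun ω => R ω ^ φ) V P :=
    hRV.comp (φ := fun y : ℝ => y ^ φ) (ψ := id) (by fun_prop) measurable_id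
  obtain ⟨hint, hne⟩ : Integrable (fun ω => R ω ^ φ) P ∧ ∫ ω, R ω ^ φ ∂P ≠ 0 := by
    -- For `φ = 0` the variable is constantly `1` and has no power tail, so this case is separate.
    rcases hφ0.eq_or_lt with rfl | hφ0
    · simp
    · have ht := tendsto_rpow_mul_tail_rpow hR0 hφ0 htail
      have hint := integrable_of_tendsto_rpow_mul_tail hTm hT0 ((one_lt_div hφ0).2 hφ) ht
      exact ⟨hint, integral_ne_zero_of_tendsto_rpow_mul_tail hT0 hint hc ht⟩
  refine ⟨hint, ?_⟩
  have h1 : (fun x : ℝ => ∫ ω, min x (R ω ^ φ) ∂P) ~[atTop] fun _ => ∫ ω, R ω ^ φ ∂P :=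
    (isEquivalent_const_iff_tendsto hne).2 (tendsto_integral_min hT0 hint)
  refine (h1.mul (IsEquivalent.refl (u := fun x : ℝ => x⁻¹))).congr_left ?_
  filter_upwards [eventually_gt_atTop 0] with x hx
  rw [measureReal_lt_mul_pareto hTm hT0 hV hTV hx, Pi.mul_apply, mul_comm]

/-- Common to `φ > α` and `φ = α`: in both, `E min(x, T)` diverges and follows the integral of the
tail. -/
lemma isEquivalent_tail_rpow_mul_pareto (hR : AEMeasurable R P) (hR0 : 0 ≤ᵐ[P] R)
    (hV : HasLaw V (paretoMeasure 1 1) P) (hRV : IndepFun R V P) (hc : 0 < c)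
    (htail : Tendsto (fun t : ℝ => t ^ α * P.real {ω | t < R ω}) atTop (𝓝 c)) (hφ : 0 < φ)
    (hH : Tendsto (fun x : ℝ => ∫ t in (1 : ℝ)..x, t ^ (-(α / φ))) atTop atTop) :
    (fun x : ℝ => P.real {ω | x < R ω ^ φ * V ω}) ~[atTop]
      fun x : ℝ => x⁻¹ * (c * ∫ t in (1 : ℝ)..x, t ^ (-(α / φ))) := by
  have hT0 : 0 ≤ᵐ[P] fun ω => R ω ^ φ := by
    filter_upwards [hR0] with ω hω using Real.rpow_nonneg hω _
  have hTm : AEMeasurable (fun ω => R ω ^ φ) P := hR.pow_const φ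
  have hTV : IndepFun (fun ω => R ω ^ φ) V P :=
    hRV.comp (φ := fun y : ℝ => y ^ φ) (ψ := id) (by fun_prop) measurable_id
  have h1 := isEquivalent_integral_of_tendsto_rpow_mul
    (antitone_measureReal_lt (P := P) fun ω => R ω ^ φ) hc
    (tendsto_rpow_mul_tail_rpow hR0 hφ htail) hH
  refine ((IsEquivalent.refl (u := fun x : ℝ => x⁻¹)).mul h1).congr_left ?_
  filter_upwards [eventually_gt_atTop 0] with x hx
  rw [measureReal_lt_mul_pareto hTm hT0 hV hTV hx, Pi.mul_apply,
    integral_min_eq_intervalIntegral hTm hT0 hx.le]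

lemma isEquivalent_tail_rpow_mul_pareto_of_gt (hR : AEMeasurable R P) (hR0 : 0 ≤ᵐ[P] R)
    (hV : HasLaw V (paretoMeasure 1 1) P) (hRV : IndepFun R V P) (hα : 0 < α) (hc : 0 < c)
    (htail : Tendsto (fun t : ℝ => t ^ α * P.real {ω | t < R ω}) atTop (𝓝 c)) (hφ : α < φ) :
    (fun x : ℝ => P.real {ω | x < R ω ^ φ * V ω}) ~[atTop]
      fun x : ℝ => c / (1 - α / φ) * x ^ (-(α / φ)) := by
  have hφ0 : 0 < φ := hα.trans hφ
  have hρ : α / φ < 1 := (div_lt_one hφ0).2 hφ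
  obtain ⟨hH, hHeq⟩ := isEquivalent_integral_rpow_neg hρ
  refine (isEquivalent_tail_rpow_mul_pareto hR hR0 hV hRV hc htail hφ0 hH).trans ?_
  refine ((IsEquivalent.refl (u := fun x : ℝ => x⁻¹)).mul
    ((IsEquivalent.refl (u := fun _ : ℝ => c)).mul hHeq)).congr_right ?_
  filter_upwards [eventually_gt_atTop 0] with x hx
  simp only [Pi.mul_apply]
  rw [sub_eq_add_neg 1 (α / φ), Real.rpow_add hx, Real.rpow_one]
  field_simp

lemma isEquivalent_tail_rpow_mul_pareto_of_eq (hR : AEMeasurable R P) (hR0 : 0 ≤ᵐ[P] R)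
    (hV : HasLaw V (paretoMeasure 1 1) P) (hRV : IndepFun R V P) (hα : 0 < α) (hc : 0 < c)
    (htail : Tendsto (fun t : ℝ => t ^ α * P.real {ω | t < R ω}) atTop (𝓝 c)) (hφ : φ = α) :
    (fun x : ℝ => P.real {ω | x < R ω ^ φ * V ω}) ~[atTop]
      fun x : ℝ => c * (x⁻¹ * Real.log x) := by
  subst hφ
  have hlog : (fun x : ℝ => ∫ t in (1 : ℝ)..x, t ^ (-(φ / φ))) =ᶠ[atTop] Real.log := by
    filter_upwards [eventually_gt_atTop 0] with x hx
    simp_rw [div_self hα.ne', Real.rpow_neg_one]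
    rw [integral_inv_of_pos one_pos hx, div_one]
  have hH := Real.tendsto_log_atTop.congr' hlog.symm
  refine (isEquivalent_tail_rpow_mul_pareto hR hR0 hV hRV hc htail hα hH).congr_right ?_
  filter_upwards [hlog] with x hx
  rw [hx]
  ring

end MixtureTails

/-! ### Convex combinations of stable variables. -/

lemma scaleBar_rpow {K : ℕ} {α : ℝ} (hα0 : 0 < α)
    {w : Fin K → EuclideanSpace ℝ (Fin 2) → ℝ → ℝ} {r γ : Fin K → ℝ}
    {s : EuclideanSpace ℝ (Fin 2)} (hw : ∀ k, 0 ≤ w k s (r k)) (hγ : ∀ k, 0 < γ k) :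
    scaleBar α w r γ s ^ α = ∑ k, (w k s (r k) * γ k) ^ α := by
  rw [scaleBar, one_div]
  refine Real.rpow_inv_rpow (Finset.sum_nonneg fun k _ => ?_) hα0.ne'
  exact Real.rpow_nonneg (mul_nonneg (hw k) (hγ k).le) _

lemma sum_mul_rpow_pos {K : ℕ} {α : ℝ} {a γ : Fin K → ℝ} (ha : ∀ k, 0 ≤ a k)
    (hsum : ∑ k, a k = 1) (hγ : ∀ k, 0 < γ k) : 0 < ∑ k, (a k * γ k) ^ α := by
  obtain ⟨k, -, hk⟩ : ∃ k ∈ Finset.univ, a k ≠ 0 :=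
    Finset.exists_ne_zero_of_sum_ne_zero (by rw [hsum]; exact one_ne_zero)
  have hk0 : 0 < a k := lt_of_le_of_ne (ha k) (Ne.symm hk)
  exact Finset.sum_pos' (fun j _ => Real.rpow_nonneg (mul_nonneg (ha j) (hγ j).le) _)
    ⟨k, Finset.mem_univ k, Real.rpow_pos_of_pos (mul_pos hk0 (hγ k)) _⟩

/-- A convex combination of independent totally skewed stable variables with common index and
location is again totally skewed stable. -/
lemma charFun_map_sum_stable {Ω : Type*} [MeasurableSpace Ω] {P : Measure Ω}
    [IsProbabilityMeasure P] {K : ℕ} {α δ : ℝ} (hα0 : 0 < α) (hα1 : α < 1) {γ a : Fin K → ℝ}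
    (ha : ∀ k, 0 ≤ a k) (hsum : ∑ k, a k = 1) {S : Fin K → Ω → ℝ}
    (hS_law : ∀ k, HasStableLaw (S k) P α 1 (γ k) δ) (hS_indep : iIndepFun S P) (u : ℝ) :
    charFun (P.map fun ω => ∑ k, a k * S k ω) u =
      Complex.exp (-((∑ k, (a k * γ k) ^ α : ℝ) : ℂ) * skewedExponent α u +
        Complex.I * ((δ * u : ℝ) : ℂ)) := by
  have hindep : iIndepFun (fun k ω => a k * S k ω) P :=
    hS_indep.comp (fun k y => a k * y) fun k => measurable_const_mul (a k)
  have hterm : ∀ k, charFun (P.map fun ω => a k * S k ω) u =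
      Complex.exp (-(((a k * γ k) ^ α : ℝ) : ℂ) * skewedExponent α u +
        (a k : ℂ) * (Complex.I * ((δ * u : ℝ) : ℂ))) := by
    intro k
    rw [charFun_map_mul_comp (hS_law k).aemeasurable, (hS_law k).charFun_eq]
    have h1 := skewedExponent_mul hα0 (ha k) u
    rw [Real.mul_rpow (ha k) (hS_law k).gamma_pos.le]
    congr 1
    have h2 : stableOmega α (a k * u) = Real.tan (Real.pi * α / 2) := by
      simp [stableOmega, hα1.ne]
    rw [h2]
    rw [skewedExponent] at h1
    push_cast at h1 ⊢
    rw [one_mul]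
    linear_combination -((γ k ^ α : ℝ) : ℂ) * h1
  rw [hindep.charFun_map_fun_sum_eq_prod fun k => (hS_law k).aemeasurable.const_mul (a k),
    Finset.prod_apply]
  simp_rw [hterm]
  -- The locations add up to `(∑ a k) δ = δ`, the `α`-th powers of the scales to the new
  -- coefficient.
  rw [← Complex.exp_sum, Finset.sum_add_distrib, ← Finset.sum_mul, ← Finset.sum_mul,
    Finset.sum_neg_distrib, ← Complex.ofReal_sum, ← Complex.ofReal_sum, hsum, Complex.ofReal_one,
    one_mul]

end

/-! ### The mixture process at one location. -/

theorem proposition1 {Ω : Type*} [MeasurableSpace Ω] (P : Measure Ω) [IsProbabilityMeasure P]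
    -- parameters of the stable variables; `α < 1` and `0 ≤ δ` make `R(s)` nonnegative
    {K : ℕ} (α δ : ℝ) (hα0 : 0 < α) (hα1 : α < 1) (hδ : 0 ≤ δ) (γ : Fin K → ℝ)
    -- spatial domain and nonnegative basis functions summing to one on it
    (D : Set (EuclideanSpace ℝ (Fin 2)))
    (w : Fin K → EuclideanSpace ℝ (Fin 2) → ℝ → ℝ) (r : Fin K → ℝ)
    (hw_nonneg : ∀ k, ∀ s ∈ D, 0 ≤ w k s (r k))
    (hw_sum : ∀ s ∈ D, ∑ k, w k s (r k) = 1)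
    -- independent stable variables
    (S : Fin K → Ω → ℝ) (hS_law : ∀ k, HasStableLaw (S k) P α 1 (γ k) δ)
    (hS_indep : iIndepFun S P)
    -- the process `Z`, independent of the stable variables, and the link to standard Pareto margins
    (Z : D → Ω → ℝ) (hZ : ∀ s, AEMeasurable (Z s) P)
    (hSZ : IndepFun (fun ω k => S k ω) (fun ω s => Z s ω) P)
    (g : ℝ → ℝ) (hg : Measurable g)
    (hg_law : ∀ s, HasLaw (fun ω => g (Z s ω)) (paretoMeasure 1 1) P)
    -- the tail parameter surface and a location
    (φ : D → ℝ) (s : D) :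
    (0 ≤ φ s → φ s < α →
      Integrable (fun ω => scalingProcess w r S s ω ^ φ s) P ∧
      (fun x : ℝ => P.real {ω | x < mixtureProcess w r S φ g Z s ω}) ~[atTop]
        (fun x : ℝ => (∫ ω, scalingProcess w r S s ω ^ φ s ∂P) * x⁻¹)) ∧
    (α < φ s →
      (fun x : ℝ => P.real {ω | x < mixtureProcess w r S φ g Z s ω}) ~[atTop]
        (fun x : ℝ => 2 * stableTailConst α * scaleBar α w r γ s ^ α / (1 - α / φ s)
          * x ^ (-(α / φ s)))) ∧
    (φ s = α →
      (fun x : ℝ => P.real {ω | x < mixtureProcess w r S φ g Z s ω}) ~[atTop]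
        (fun x : ℝ => 2 * stableTailConst α * scaleBar α w r γ s ^ α
          * (x⁻¹ * Real.log x))) := by
  have hw : ∀ k, 0 ≤ w k s (r k) := fun k => hw_nonneg k s s.2
  have hγ : ∀ k, 0 < γ k := fun k => (hS_law k).gamma_pos
  have hRm : AEMeasurable (scalingProcess w r S s) P :=
    Finset.aemeasurable_fun_sum _ fun k _ => (hS_law k).aemeasurable.const_mul _
  set c : ℝ := ∑ k, (w k s (r k) * γ k) ^ α
  have hc : 0 < c := sum_mul_rpow_pos hw (hw_sum s s.2) hγ
  have hprob : IsProbabilityMeasure (P.map (scalingProcess w r S s)) :=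
    Measure.isProbabilityMeasure_map hRm
  have hcf : ∀ u, charFun (P.map (scalingProcess w r S s)) u =
      Complex.exp (-(c : ℂ) * skewedExponent α u + Complex.I * ((δ * u : ℝ) : ℂ)) :=
    charFun_map_sum_stable hα0 hα1 hw (hw_sum s s.2) hS_law hS_indep
  have hR0 : 0 ≤ᵐ[P] scalingProcess w r S s := by
    have h := measure_Iio_zero_of_charFun_eq hα0 hα1 hc hδ hcf
    rw [Measure.map_apply_of_aemeasurable hRm measurableSet_Iio] at h
    refine ae_iff.2 (measure_mono_null (fun ω hω => ?_) h)
    exact not_le.1 hω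
  have htail : Tendsto (fun t : ℝ => t ^ α * P.real {ω | t < scalingProcess w r S s ω}) atTop
      (nhds (2 * stableTailConst α * c)) := by
    refine (tendsto_rpow_mul_tail_of_charFun_eq hα0 hα1 hc hcf).congr fun t => ?_
    have hmeas : MeasurableSet {x : ℝ | t < |x|} :=
      measurableSet_lt measurable_const measurable_norm
    rw [map_measureReal_apply_of_aemeasurable hRm hmeas]
    congr 1
    refine measureReal_congr ?_
    filter_upwards [hR0] with ω hω
    exact congrArg (t < ·) (abs_of_nonneg hω)
  have hRV : IndepFun (scalingProcess w r S s) (fun ω => g (Z s ω)) P :=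
    hSZ.comp (φ := fun y : Fin K → ℝ => ∑ k, w k s (r k) * y k) (ψ := fun z : D → ℝ => g (z s))
      (by fun_prop) (hg.comp (measurable_pi_apply s))
  have hcpos : 0 < 2 * stableTailConst α * c := mul_pos (stableTailConst_pos hα0 hα1) hc
  rw [scaleBar_rpow hα0 hw hγ]
  refine ⟨fun h0 h1 => ?_, fun h1 => ?_, fun h1 => ?_⟩
  · exact isEquivalent_tail_rpow_mul_pareto_of_lt hRm hR0 (hg_law s) hRV hcpos htail h0 h1
  · exact isEquivalent_tail_rpow_mul_pareto_of_gt hRm hR0 (hg_law s) hRV hα0 hcpos htail h1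
  · exact isEquivalent_tail_rpow_mul_pareto_of_eq hRm hR0 (hg_law s) hRV hα0 hcpos htail h1
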